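/- Let $N\ge 1$, $0<s<1$, $1<p<\infty$, let $p'=\frac{p}{p-1}$, and let $\Omega\subseteq\mathbb R^N$ be open. Write $$[u]_{s,p}=\Big(\iint_{\mathbb R^{2N}}\frac{|u(x)-u(y)|^p}{|x-y|^{N+sp}}\,dx\,dy\Big)^{1/p},$$ let $\mathcal D_0^{s,p}(\Omega)$ be the completion of $C_0^\infty(\Omega)$ with respect to $[\,\cdot\,]_{s,p}$, and suppose that the embedding $\mathcal D_0^{s,p}(\Omega)\hookrightarrow L^1(\Omega)$ (the bounded linear operator extending the inclusion of $C_0^\infty(\Omega)$ into $L^1(\Omega)$) exists and is compact. Regard elements of $\mathcal D_0^{s,p}(\Omega)$ as functions in $L^1(\Omega)$ via this embedding, extended by $0$ to $\mathbb R^N$. Then the minimum problem $$\min_{u\in\mathcal D_0^{s,p}(\Omega)}\Big\{\frac1p\iint_{\mathbb R^{2N}}\frac{|u(x)-u(y)|^p}{|x-y|^{N+sp}}\,dx\,dy-\int_\Omega u\,dx\Big\}$$ has a unique solution, called the $(s,p)$-torsion function $w=w_{s,p,\Omega}$, and $w\in L^\infty(\Omega)$. Moreover, if $sp<N$, then $$\|w\|_{L^\infty(\Omega)}\le\frac{N+sp'}{sp'}\,\mathcal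 S(N,s,p)^{-\frac{N}{Np+sp-N}}\Big(\int_\Omega w\,dx\Big)^{\frac{sp'}{N+sp'}},$$ where $\mathcal S(N,s,p)=\inf\big\{[u]_{s,p}^p: u\in C_0^\infty(\mathbb R^N),\ \|u\|_{L^{Np/(N-sp)}(\mathbb R^N)}=1\big\}$ is the best constant in the fractional Sobolev inequality. -/

import Mathlib

open MeasureTheory TopologicalSpace Set
open scoped ENNReal Distributions

/-- The Gagliardo energy `∬ |u x - u y| ^ p / |x - y| ^ (N + s p) dx dy` of a function on `ℝ^N`,
as an extended nonnegative number. -/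
noncomputable def gagliardoEnergy {N : ℕ} (s p : ℝ) (u : EuclideanSpace ℝ (Fin N) → ℝ) : ℝ≥0∞ :=
  ∫⁻ z : EuclideanSpace ℝ (Fin N) × EuclideanSpace ℝ (Fin N),
    ENNReal.ofReal (|u z.1 - u z.2| ^ p / ‖z.1 - z.2‖ ^ (N + s * p))

/-- The difference quotient whose `L^p` norm on `ℝ^N × ℝ^N` is the Gagliardo seminorm. -/
noncomputable def gagliardoQuotient {N : ℕ} (s p : ℝ) (u : EuclideanSpace ℝ (Fin N) → ℝ)
    (z : EuclideanSpace ℝ (Fin N) × EuclideanSpace ℝ (Fin N)) : ℝ :=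
  (u z.1 - u z.2) * ‖z.1 - z.2‖ ^ (-((N + s * p) / p))

theorem gagliardoEnergy_eq_eLpNorm {N : ℕ} {s p : ℝ} (hp : 1 < p)
    (u : EuclideanSpace ℝ (Fin N) → ℝ) :
    gagliardoEnergy s p u =
      eLpNorm (gagliardoQuotient s p u) (ENNReal.ofReal p) volume ^ p := by
  have hp0 : 0 < p := by linarith
  rw [eLpNorm_eq_lintegral_rpow_enorm_toReal (by simpa using hp0) ENNReal.ofReal_ne_top,
    ENNReal.toReal_ofReal hp0.le, ← ENNReal.rpow_mul, one_div, inv_mul_cancel₀ hp0.ne',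
    ENNReal.rpow_one]
  refine lintegral_congr fun z => ?_
  rw [← ofReal_norm, ENNReal.ofReal_rpow_of_nonneg (norm_nonneg _) hp0.le]
  congr 1
  rw [gagliardoQuotient, norm_mul, Real.mul_rpow (norm_nonneg _) (norm_nonneg _),
    Real.norm_eq_abs, Real.norm_of_nonneg (Real.rpow_nonneg (norm_nonneg _) _),
    ← Real.rpow_mul (norm_nonneg _), neg_mul, div_mul_cancel₀ _ hp0.ne',
    Real.rpow_neg (norm_nonneg _), div_eq_mul_inv]

theorem lintegral_gagliardoKernel_lt_top {N : ℕ} {s p : ℝ} (hs : s ∈ Ioo (0 : ℝ) 1) (hp : 1 < p) :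
    ∫⁻ h : EuclideanSpace ℝ (Fin N),
      ENNReal.ofReal ((min 1 ‖h‖) ^ p / ‖h‖ ^ (N + s * p)) < ∞ := by
  have hp0 : 0 < p := by linarith
  have hsp : 0 < s * p := mul_pos hs.1 hp0
  have hspp : s * p < p := by nlinarith [hs.2]
  rcases Nat.eq_zero_or_pos N with rfl | hN
  · have : ∀ h : EuclideanSpace ℝ (Fin 0), h = 0 := fun h => Subsingleton.elim _ _
    refine (lintegral_congr fun h => ?_).trans_lt ((lintegral_zero).trans_lt ENNReal.zero_lt_top)
    rw [this h]
    simp [Real.zero_rpow hp0.ne']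
  have : Nonempty (Fin N) := ⟨⟨0, hN⟩⟩
  have h1 : IntegrableOn (fun h : EuclideanSpace ℝ (Fin N) => ‖h‖ ^ (p - (N + s * p)))
      (Metric.ball 0 1) := by
    refine (integrableOn_fun_norm_addHaar (f := fun y : ℝ => y ^ (p - (N + s * p))) volume).2 ?_
    have h2 : IntegrableOn (fun y : ℝ => y ^ (p - s * p - 1)) (Ioo 0 1) := by
      have := intervalIntegral.intervalIntegrable_rpow' (a := 0) (b := 1)
        (r := p - s * p - 1) (by linarith)
      rw [intervalIntegrable_iff_integrableOn_Ioo_of_le zero_le_one] at this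
      exact this
    refine h2.congr_fun (fun y hy => ?_) measurableSet_Ioo
    have hcast : ((N - 1 : ℕ) : ℝ) = N - 1 := by
      rw [Nat.cast_sub hN, Nat.cast_one]
    simp only [finrank_euclideanSpace, Fintype.card_fin, smul_eq_mul]
    rw [← Real.rpow_natCast, ← Real.rpow_add hy.1, hcast]
    congr 1
    ring
  have h3 := finite_integral_one_add_norm (E := EuclideanSpace ℝ (Fin N)) (μ := volume)
    (r := N + s * p) (by simpa using hsp)
  have hle : ∀ h : EuclideanSpace ℝ (Fin N),
      ENNReal.ofReal ((min 1 ‖h‖) ^ p / ‖h‖ ^ (N + s * p)) ≤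
        (Metric.ball 0 1).indicator
          (fun h => ENNReal.ofReal (‖h‖ ^ (p - (N + s * p)))) h +
        ENNReal.ofReal (2 ^ (N + s * p)) * ENNReal.ofReal ((1 + ‖h‖) ^ (-(N + s * p))) := by
    intro h
    rcases eq_or_ne h 0 with rfl | hh
    · simp [Real.zero_rpow hp0.ne']
    have hpos : 0 < ‖h‖ := norm_pos_iff.2 hh
    by_cases hb : h ∈ Metric.ball (0 : EuclideanSpace ℝ (Fin N)) 1
    · rw [indicator_of_mem hb]
      refine le_trans (ENNReal.ofReal_le_ofReal ?_) le_self_add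
      rw [Real.rpow_sub hpos]
      gcongr
      exact min_le_right _ _
    · rw [indicator_of_notMem hb, zero_add, ← ENNReal.ofReal_mul (by positivity)]
      refine ENNReal.ofReal_le_ofReal ?_
      have hb' : 1 ≤ ‖h‖ := by simpa using hb
      rw [min_eq_left hb', Real.one_rpow, Real.rpow_neg (by positivity), ← div_eq_mul_inv,
        ← Real.div_rpow (by norm_num) (by positivity), one_div,
        ← Real.inv_rpow hpos.le]
      refine Real.rpow_le_rpow (by positivity) ?_ (by positivity)
      rw [inv_eq_one_div, div_le_div_iff₀ hpos (by positivity)]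
      linarith
  refine (lintegral_mono hle).trans_lt ?_
  rw [lintegral_add_right _ (by fun_prop), lintegral_const_mul _ (by fun_prop),
    lintegral_indicator measurableSet_ball]
  refine ENNReal.add_lt_top.2 ⟨?_, ENNReal.mul_lt_top ENNReal.ofReal_lt_top h3⟩
  exact h1.lintegral_lt_top

/-- The Gagliardo energy of a test function is finite. -/
theorem gagliardoEnergy_testFunction_lt_top {N : ℕ} {s p : ℝ} (hs : s ∈ Ioo (0 : ℝ) 1)
    (hp : 1 < p) {Ω : Opens (EuclideanSpace ℝ (Fin N))} (φ : 𝓓(Ω, ℝ)) :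
    gagliardoEnergy s p φ < ∞ := by
  have hp0 : 0 < p := by linarith
  obtain ⟨L, hL⟩ := ContDiff.lipschitzWith_of_hasCompactSupport φ.hasCompactSupport φ.contDiff
    (by simp)
  obtain ⟨M, hM⟩ := φ.hasCompactSupport.exists_bound_of_continuous φ.continuous
  have hM0 : 0 ≤ M := (norm_nonneg _).trans (hM 0)
  set A : ℝ := max L (2 * M) with hA
  have hA0 : 0 ≤ A := le_trans (by positivity) (le_max_right _ _)
  set g : EuclideanSpace ℝ (Fin N) → ℝ≥0∞ := fun h =>
    ENNReal.ofReal ((min 1 ‖h‖) ^ p / ‖h‖ ^ (N + s * p)) with hg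
  have hgm : Measurable g := by fun_prop
  have hgs : ∀ h, g (-h) = g h := fun h => by simp [hg]
  have hgf : ∫⁻ h, g h < ∞ := lintegral_gagliardoKernel_lt_top hs hp
  set K := tsupport φ with hK
  have hKm : MeasurableSet K := (isClosed_tsupport _).measurableSet
  have hKf : volume K < ∞ := φ.hasCompactSupport.isCompact.measure_lt_top
  have hdiff : ∀ x y, |φ x - φ y| ≤ A * min 1 ‖x - y‖ := by
    intro x y
    rcases le_total 1 ‖x - y‖ with h | h
    · rw [min_eq_left h, mul_one]
      refine le_trans ?_ (le_max_right _ _)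
      have h1 := hM x
      have h2 := hM y
      rw [Real.norm_eq_abs] at h1 h2
      have := abs_sub (φ x) (φ y)
      linarith
    · rw [min_eq_right h]
      have := hL.dist_le_mul x y
      rw [Real.dist_eq, dist_eq_norm] at this
      exact this.trans (mul_le_mul_of_nonneg_right (le_max_left _ _) (norm_nonneg _))
  have hle : ∀ z : EuclideanSpace ℝ (Fin N) × EuclideanSpace ℝ (Fin N),
      ENNReal.ofReal (|φ z.1 - φ z.2| ^ p / ‖z.1 - z.2‖ ^ (N + s * p)) ≤
        ENNReal.ofReal (A ^ p) * (K.indicator 1 z.1 * g (z.1 - z.2)) +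
        ENNReal.ofReal (A ^ p) * (K.indicator 1 z.2 * g (z.2 - z.1)) := by
    rintro ⟨x, y⟩
    have hb : ENNReal.ofReal (|φ x - φ y| ^ p / ‖x - y‖ ^ (N + s * p)) ≤
        ENNReal.ofReal (A ^ p) * g (x - y) := by
      rw [hg, ← ENNReal.ofReal_mul (by positivity), ← mul_div_assoc,
        ← Real.mul_rpow hA0 (by positivity)]
      refine ENNReal.ofReal_le_ofReal ?_
      gcongr
      exact hdiff x y
    by_cases hx : x ∈ K
    · refine le_trans ?_ le_self_add
      simpa [hx] using hb
    by_cases hy : y ∈ K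
    · refine le_trans ?_ le_add_self
      have : g (y - x) = g (x - y) := by rw [← hgs, neg_sub]
      simpa [hy, this] using hb
    · simp [image_eq_zero_of_notMem_tsupport hx, image_eq_zero_of_notMem_tsupport hy,
        Real.zero_rpow hp0.ne']
  have hI : Measurable (K.indicator (1 : EuclideanSpace ℝ (Fin N) → ℝ≥0∞)) :=
    measurable_one.indicator hKm
  have hfin : ∫⁻ x, ∫⁻ y, K.indicator 1 x * g (x - y) < ∞ := by
    have : ∀ x : EuclideanSpace ℝ (Fin N), ∫⁻ y, K.indicator 1 x * g (x - y)
        = K.indicator 1 x * ∫⁻ h, g h := by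
      intro x
      rw [lintegral_const_mul _ (by fun_prop), lintegral_sub_left_eq_self g x]
    simp_rw [this]
    rw [lintegral_mul_const _ hI, lintegral_indicator_one hKm]
    exact ENNReal.mul_lt_top hKf hgf
  refine (lintegral_mono hle).trans_lt ?_
  rw [lintegral_add_right _ (by fun_prop), lintegral_const_mul _ (by fun_prop),
    lintegral_const_mul _ (by fun_prop)]
  refine ENNReal.add_lt_top.2 ⟨ENNReal.mul_lt_top ENNReal.ofReal_lt_top ?_,
    ENNReal.mul_lt_top ENNReal.ofReal_lt_top ?_⟩
  · rw [Measure.volume_eq_prod, lintegral_prod _ (by fun_prop)]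
    exact hfin
  · rw [Measure.volume_eq_prod, lintegral_prod_symm _ (by fun_prop)]
    exact hfin

theorem memLp_gagliardoQuotient {N : ℕ} {s p : ℝ} (hs : s ∈ Ioo (0 : ℝ) 1) (hp : 1 < p)
    {Ω : Opens (EuclideanSpace ℝ (Fin N))} (φ : 𝓓(Ω, ℝ)) :
    MemLp (gagliardoQuotient s p φ) (ENNReal.ofReal p) volume := by
  have hp0 : 0 < p := by linarith
  refine ⟨?_, ?_⟩
  · have h : Measurable fun x => φ x := φ.continuous.measurable
    refine Measurable.aestronglyMeasurable ?_
    unfold gagliardoQuotient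
    fun_prop
  · have := gagliardoEnergy_testFunction_lt_top hs hp φ
    rw [gagliardoEnergy_eq_eLpNorm hp] at this
    exact (ENNReal.rpow_lt_top_iff_of_pos hp0).1 this

/-- The Gagliardo norm `[u]_{s,p}`, as a seminorm on `C_0^∞(Ω)`. -/
noncomputable def gagliardoSeminorm {N : ℕ} {s p : ℝ} (hs : s ∈ Ioo (0 : ℝ) 1) (hp : 1 < p)
    (Ω : Opens (EuclideanSpace ℝ (Fin N))) : Seminorm ℝ 𝓓(Ω, ℝ) :=
  Seminorm.of (fun φ => (gagliardoEnergy s p φ).toReal ^ (1 / p))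
    (by
      have hp0 : 0 < p := by linarith
      have key : ∀ φ : 𝓓(Ω, ℝ), (gagliardoEnergy s p φ).toReal ^ (1 / p) =
          (eLpNorm (gagliardoQuotient s p φ) (ENNReal.ofReal p) volume).toReal := fun φ => by
        rw [gagliardoEnergy_eq_eLpNorm hp, ← ENNReal.toReal_rpow, one_div,
          Real.rpow_rpow_inv ENNReal.toReal_nonneg hp0.ne']
      intro φ ψ
      have hadd : gagliardoQuotient s p (φ + ψ : 𝓓(Ω, ℝ)) =
          gagliardoQuotient s p φ + gagliardoQuotient s p ψ := by
        funext z
        simp only [gagliardoQuotient, Pi.add_apply, FunLike.coe_add]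
        ring
      have hφ := memLp_gagliardoQuotient hs hp φ
      have hψ := memLp_gagliardoQuotient hs hp ψ
      rw [key, key, key, hadd, ← ENNReal.toReal_add hφ.2.ne hψ.2.ne]
      exact ENNReal.toReal_mono (ENNReal.add_ne_top.2 ⟨hφ.2.ne, hψ.2.ne⟩)
        (eLpNorm_add_le hφ.1 hψ.1 (by simpa using hp.le)))
    (by
      have hp0 : 0 < p := by linarith
      intro c φ
      have hsmul : gagliardoQuotient s p (c • φ : 𝓓(Ω, ℝ)) = c • gagliardoQuotient s p φ := by
        funext z
        simp only [gagliardoQuotient, Pi.smul_apply, FunLike.coe_smul, smul_eq_mul]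
        ring
      rw [gagliardoEnergy_eq_eLpNorm hp, gagliardoEnergy_eq_eLpNorm hp, ← ENNReal.toReal_rpow,
        ← ENNReal.toReal_rpow, one_div, Real.rpow_rpow_inv ENNReal.toReal_nonneg hp0.ne',
        Real.rpow_rpow_inv ENNReal.toReal_nonneg hp0.ne', hsmul, eLpNorm_const_smul,
        ENNReal.toReal_mul, toReal_enorm])

/-- `C_0^∞(Ω)`, to be equipped with the Gagliardo norm `[u]_{s,p}` (instead of the usual topology
of the space of test functions). -/
def GagliardoTestSpace {N : ℕ} {s p : ℝ} (_hs : s ∈ Ioo (0 : ℝ) 1) (_hp : 1 < p)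
    (Ω : Opens (EuclideanSpace ℝ (Fin N))) : Type :=
  𝓓(Ω, ℝ)

noncomputable instance instGagliardoTestSpaceAddCommGroup {N : ℕ} {s p : ℝ}
    (hs : s ∈ Ioo (0 : ℝ) 1) (hp : 1 < p) (Ω : Opens (EuclideanSpace ℝ (Fin N))) :
    AddCommGroup (GagliardoTestSpace hs hp Ω) :=
  inferInstanceAs (AddCommGroup 𝓓(Ω, ℝ))

noncomputable instance instGagliardoTestSpaceModule {N : ℕ} {s p : ℝ}
    (hs : s ∈ Ioo (0 : ℝ) 1) (hp : 1 < p) (Ω : Opens (EuclideanSpace ℝ (Fin N))) :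
    Module ℝ (GagliardoTestSpace hs hp Ω) :=
  inferInstanceAs (Module ℝ 𝓓(Ω, ℝ))

noncomputable instance instGagliardoTestSpaceSeminormed {N : ℕ} {s p : ℝ}
    (hs : s ∈ Ioo (0 : ℝ) 1) (hp : 1 < p) (Ω : Opens (EuclideanSpace ℝ (Fin N))) :
    SeminormedAddCommGroup (GagliardoTestSpace hs hp Ω) :=
  AddGroupSeminorm.toSeminormedAddCommGroup (gagliardoSeminorm hs hp Ω).toAddGroupSeminorm

noncomputable instance instGagliardoTestSpaceNormedSpace {N : ℕ} {s p : ℝ}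
    (hs : s ∈ Ioo (0 : ℝ) 1) (hp : 1 < p) (Ω : Opens (EuclideanSpace ℝ (Fin N))) :
    NormedSpace ℝ (GagliardoTestSpace hs hp Ω) where
  norm_smul_le c φ := (map_smul_eq_mul (gagliardoSeminorm hs hp Ω) c φ).le

/-- The test function underlying an element of `GagliardoTestSpace`. -/
def GagliardoTestSpace.toTestFunction {N : ℕ} {s p : ℝ} {hs : s ∈ Ioo (0 : ℝ) 1} {hp : 1 < p}
    {Ω : Opens (EuclideanSpace ℝ (Fin N))} (φ : GagliardoTestSpace hs hp Ω) : 𝓓(Ω, ℝ) :=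
  φ

theorem GagliardoTestSpace.norm_eq {N : ℕ} {s p : ℝ} {hs : s ∈ Ioo (0 : ℝ) 1} {hp : 1 < p}
    {Ω : Opens (EuclideanSpace ℝ (Fin N))} (φ : GagliardoTestSpace hs hp Ω) :
    ‖φ‖ = (gagliardoEnergy s p φ.toTestFunction).toReal ^ (1 / p) :=
  rfl

/-- The homogeneous fractional Sobolev space `D_0^{s,p}(Ω)`: the completion of `C_0^∞(Ω)` with
respect to the Gagliardo norm `[u]_{s,p}`. -/
abbrev HomogeneousSobolev {N : ℕ} {s p : ℝ} (hs : s ∈ Ioo (0 : ℝ) 1) (hp : 1 < p)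
    (Ω : Opens (EuclideanSpace ℝ (Fin N))) : Type :=
  UniformSpace.Completion (GagliardoTestSpace hs hp Ω)

/-- The class in `L^1(Ω)` of a test function. -/
noncomputable def GagliardoTestSpace.toL1 {N : ℕ} {s p : ℝ} {hs : s ∈ Ioo (0 : ℝ) 1} {hp : 1 < p}
    {Ω : Opens (EuclideanSpace ℝ (Fin N))} (φ : GagliardoTestSpace hs hp Ω) :
    Lp ℝ 1 (volume.restrict (Ω : Set (EuclideanSpace ℝ (Fin N)))) :=
  MemLp.toLp φ.toTestFunction (φ.toTestFunction.continuous.memLp_of_hasCompactSupport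
    φ.toTestFunction.hasCompactSupport)

/-- `ι` is the (continuous) embedding `D_0^{s,p}(Ω) ↪ L^1(Ω)`: the bounded linear operator that
maps each test function to its class in `L^1(Ω)`. By density there is at most one such `ι`. -/
def IsL1Embedding {N : ℕ} {s p : ℝ} {hs : s ∈ Ioo (0 : ℝ) 1} {hp : 1 < p}
    {Ω : Opens (EuclideanSpace ℝ (Fin N))}
    (ι : HomogeneousSobolev hs hp Ω →L[ℝ]
      Lp ℝ 1 (volume.restrict (Ω : Set (EuclideanSpace ℝ (Fin N))))) : Prop :=
  ∀ φ : GagliardoTestSpace hs hp Ω, ι (φ : HomogeneousSobolev hs hp Ω) = φ.toL1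

/-- The functional `(1/p) ∬ |u x - u y| ^ p / |x - y| ^ (N + s p) dx dy - ∫_Ω u dx`, where
`u ∈ D_0^{s,p}(Ω)` is viewed through the embedding `ι` as a function on `Ω`, extended by zero
to `ℝ^N`. -/
noncomputable def torsionFunctional {N : ℕ} {s p : ℝ} {hs : s ∈ Ioo (0 : ℝ) 1} {hp : 1 < p}
    {Ω : Opens (EuclideanSpace ℝ (Fin N))}
    (ι : HomogeneousSobolev hs hp Ω →L[ℝ]
      Lp ℝ 1 (volume.restrict (Ω : Set (EuclideanSpace ℝ (Fin N)))))
    (u : HomogeneousSobolev hs hp Ω) : ℝ :=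
  1 / p * (gagliardoEnergy s p ((Ω : Set (EuclideanSpace ℝ (Fin N))).indicator (ι u))).toReal -
    ∫ x in (Ω : Set (EuclideanSpace ℝ (Fin N))), ι u x

/-- `w ∈ D_0^{s,p}(Ω)` is an `(s,p)`-torsion function on `Ω`: it minimises the torsion
functional over `D_0^{s,p}(Ω)`. -/
def IsTorsionFunction {N : ℕ} {s p : ℝ} {hs : s ∈ Ioo (0 : ℝ) 1} {hp : 1 < p}
    {Ω : Opens (EuclideanSpace ℝ (Fin N))}
    (ι : HomogeneousSobolev hs hp Ω →L[ℝ]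
      Lp ℝ 1 (volume.restrict (Ω : Set (EuclideanSpace ℝ (Fin N)))))
    (w : HomogeneousSobolev hs hp Ω) : Prop :=
  ∀ u : HomogeneousSobolev hs hp Ω, torsionFunctional ι w ≤ torsionFunctional ι u

/-- The best constant in the fractional Sobolev inequality (for `s p < N`):
`S(N,s,p) = inf {[u]_{s,p}^p : u ∈ C_0^∞(ℝ^N), ‖u‖_{L^{p^*_s}(ℝ^N)} = 1}`, `p^*_s = N p / (N - s p)`. -/
noncomputable def sobolevConst (N : ℕ) (s p : ℝ) : ℝ :=
  sInf {e : ℝ | ∃ φ : 𝓓((⊤ : Opens (EuclideanSpace ℝ (Fin N))), ℝ),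
    eLpNorm φ (ENNReal.ofReal (N * p / (N - s * p))) volume = 1 ∧
    e = (gagliardoEnergy s p φ).toReal}

/-!
The proof is elementary; it rests on the boundedness of the embedding `ι` into `L^1(Ω)`.

*The norm.* Along a sequence of test functions converging in `D_0^{s,p}(Ω)`, the difference quotients
converge in `L^p(ℝ^N × ℝ^N)`, and a subsequence of the functions converges almost everywhere. Hence
the norm of `u` in the completion is the Gagliardo seminorm of the function that `u` represents
(`gagliardoEnergy_zeroExtension`), and the torsion functional is `‖u‖ ^ p / p - ℓ u` with a bounded
linear `ℓ`.

*Existence and uniqueness.* The norm is uniformly convex, as it is an `L^p` norm of difference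
quotients. By strict convexity, compactness and homogeneity, `|a - b| ^ p` is at most
`ε (|a| ^ p + |b| ^ p)` plus a constant times the midpoint convexity defect of `|·| ^ p`
(`exists_abs_sub_rpow_le`). Therefore minimizing sequences are Cauchy (`existsUnique_minimizer`).

*Energy estimate.* Truncations `(w - k)_+` belong to the space, by approximation with smooth
contractions (`exists_zeroExtension_eq_truncation`). Comparing the minimizer `w` with `|w|` gives
`w ≥ 0`; comparing it with `w - ε (w - k)_+` and letting `ε → 0` gives `[(w - k)_+] ^ p ≤ ∫ (w - k)_+`
(`IsTorsionFunction.norm_truncation_rpow_le`).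

*Boundedness.* Write `f k = ∫ (w - k)_+`. A Sobolev or Poincaré inequality together with Hölder's
inequality bounds `f k` by `κ [(w - k)_+] |{w > k}| ^ (1 - 1/p + s/N)`, so that, by the energy
estimate, `f k ≤ κ ^ p' |{w > k}| ^ γ` with `γ = 1 + s p' / N > 1`. As `f' = -|{w > k}|`, this is a
differential inequality that forces `f` to vanish beyond an explicit level
(`ae_le_of_integral_truncation_le`). For all `s` and `p` one can use a Poincaré inequality for
functions supported in a set of finite measure (`exists_lintegral_rpow_le_gagliardoEnergy`). If
`s p < N`, the Sobolev inequality with its best constant gives the sharper bound. That this constant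
is positive is the Sobolev inequality itself; it follows from the Poincaré inequality by dyadic
truncation (`exists_lintegral_sobolev`).
-/

open Filter Topology

/-! ### Functions represented by elements of `D_0^{s,p}(Ω)` -/

section Representation

variable {N : ℕ} {s p : ℝ}

theorem ae_fst_and_snd {P : EuclideanSpace ℝ (Fin N) → Prop} (h : ∀ᵐ x, P x) :
    ∀ᵐ z : EuclideanSpace ℝ (Fin N) × EuclideanSpace ℝ (Fin N), P z.1 ∧ P z.2 := by
  rw [Measure.volume_eq_prod]
  exact (Measure.quasiMeasurePreserving_fst.ae h).and (Measure.quasiMeasurePreserving_snd.ae h)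

theorem gagliardoQuotient_congr_ae {u v : EuclideanSpace ℝ (Fin N) → ℝ} (h : u =ᵐ[volume] v) :
    gagliardoQuotient s p u =ᵐ[volume] gagliardoQuotient s p v := by
  filter_upwards [ae_fst_and_snd h] with z hz
  simp only [gagliardoQuotient, hz.1, hz.2]

theorem tendsto_gagliardoQuotient_ae {u : ℕ → EuclideanSpace ℝ (Fin N) → ℝ}
    {v : EuclideanSpace ℝ (Fin N) → ℝ} (h : ∀ᵐ x, Tendsto (fun n => u n x) atTop (𝓝 (v x))) :
    ∀ᵐ z, Tendsto (fun n => gagliardoQuotient s p (u n) z) atTop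
      (𝓝 (gagliardoQuotient s p v z)) := by
  filter_upwards [ae_fst_and_snd h] with z hz
  exact (hz.1.sub hz.2).mul_const _

theorem gagliardoQuotient_add (u v : EuclideanSpace ℝ (Fin N) → ℝ) :
    gagliardoQuotient s p (u + v) = gagliardoQuotient s p u + gagliardoQuotient s p v := by
  funext z
  simp only [gagliardoQuotient, Pi.add_apply]
  ring

theorem gagliardoQuotient_sub (u v : EuclideanSpace ℝ (Fin N) → ℝ) :
    gagliardoQuotient s p (u - v) = gagliardoQuotient s p u - gagliardoQuotient s p v := by
  funext z
  simp only [gagliardoQuotient, Pi.sub_apply]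
  ring

theorem gagliardoQuotient_smul (c : ℝ) (u : EuclideanSpace ℝ (Fin N) → ℝ) :
    gagliardoQuotient s p (c • u) = c • gagliardoQuotient s p u := by
  funext z
  simp only [gagliardoQuotient, Pi.smul_apply, smul_eq_mul]
  ring

theorem measurable_gagliardoQuotient {u : EuclideanSpace ℝ (Fin N) → ℝ} (hu : Measurable u) :
    Measurable (gagliardoQuotient s p u) := by
  unfold gagliardoQuotient
  fun_prop

variable {hs : s ∈ Ioo (0 : ℝ) 1} {hp : 1 < p} {Ω : Opens (EuclideanSpace ℝ (Fin N))}

theorem GagliardoTestSpace.eLpNorm_gagliardoQuotient (φ : GagliardoTestSpace hs hp Ω) :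
    eLpNorm (gagliardoQuotient s p φ.toTestFunction) (ENNReal.ofReal p) volume = ‖φ‖ₑ := by
  have hp0 : 0 < p := by linarith
  have h := (memLp_gagliardoQuotient hs hp φ.toTestFunction).2.ne
  rw [← ofReal_norm, GagliardoTestSpace.norm_eq, gagliardoEnergy_eq_eLpNorm hp,
    ← ENNReal.toReal_rpow, one_div, Real.rpow_rpow_inv ENNReal.toReal_nonneg hp0.ne',
    ENNReal.ofReal_toReal h]

/-- The function on `ℝ^N` that an element of `D_0^{s,p}(Ω)` represents: its image in `L^1(Ω)`,
extended by zero. -/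
noncomputable def zeroExtension
    (ι : HomogeneousSobolev hs hp Ω →L[ℝ]
      Lp ℝ 1 (volume.restrict (Ω : Set (EuclideanSpace ℝ (Fin N)))))
    (u : HomogeneousSobolev hs hp Ω) : EuclideanSpace ℝ (Fin N) → ℝ :=
  (Ω : Set (EuclideanSpace ℝ (Fin N))).indicator (ι u)

variable {ι : HomogeneousSobolev hs hp Ω →L[ℝ]
      Lp ℝ 1 (volume.restrict (Ω : Set (EuclideanSpace ℝ (Fin N))))}

theorem measurable_zeroExtension (u : HomogeneousSobolev hs hp Ω) :
    Measurable (zeroExtension ι u) :=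
  (Lp.stronglyMeasurable _).measurable.indicator Ω.isOpen.measurableSet

theorem integrable_zeroExtension (u : HomogeneousSobolev hs hp Ω) :
    Integrable (zeroExtension ι u) :=
  (integrable_indicator_iff Ω.isOpen.measurableSet).2 (L1.integrable_coeFn _)

theorem integral_zeroExtension (u : HomogeneousSobolev hs hp Ω) :
    ∫ x, zeroExtension ι u x = ∫ x in (Ω : Set (EuclideanSpace ℝ (Fin N))), ι u x :=
  integral_indicator Ω.isOpen.measurableSet

theorem indicator_ae_eq_of_restrict {f g : EuclideanSpace ℝ (Fin N) → ℝ}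
    (h : f =ᵐ[volume.restrict (Ω : Set (EuclideanSpace ℝ (Fin N)))] g) :
    (Ω : Set (EuclideanSpace ℝ (Fin N))).indicator f =ᵐ[volume]
      (Ω : Set (EuclideanSpace ℝ (Fin N))).indicator g :=
  (ae_eq_restrict_iff_indicator_ae_eq Ω.isOpen.measurableSet).1 h

theorem zeroExtension_add (u v : HomogeneousSobolev hs hp Ω) :
    zeroExtension ι (u + v) =ᵐ[volume] zeroExtension ι u + zeroExtension ι v := by
  rw [zeroExtension, zeroExtension, zeroExtension, ← indicator_add', map_add]
  exact indicator_ae_eq_of_restrict (Lp.coeFn_add _ _)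

theorem zeroExtension_sub (u v : HomogeneousSobolev hs hp Ω) :
    zeroExtension ι (u - v) =ᵐ[volume] zeroExtension ι u - zeroExtension ι v := by
  rw [zeroExtension, zeroExtension, zeroExtension, ← indicator_sub', map_sub]
  exact indicator_ae_eq_of_restrict (Lp.coeFn_sub _ _)

theorem zeroExtension_smul (c : ℝ) (u : HomogeneousSobolev hs hp Ω) :
    zeroExtension ι (c • u) =ᵐ[volume] c • zeroExtension ι u := by
  rw [zeroExtension, zeroExtension, map_smul]
  exact (indicator_ae_eq_of_restrict (Lp.coeFn_smul _ _)).trans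
    (ae_of_all _ fun x => indicator_const_smul_apply _ c (ι u) x)

theorem GagliardoTestSpace.indicator_toTestFunction (φ : GagliardoTestSpace hs hp Ω) :
    (Ω : Set (EuclideanSpace ℝ (Fin N))).indicator φ.toTestFunction = φ.toTestFunction :=
  indicator_eq_self.2 ((subset_tsupport _).trans φ.toTestFunction.tsupport_subset)

theorem zeroExtension_coe (hι : IsL1Embedding ι) (φ : GagliardoTestSpace hs hp Ω) :
    zeroExtension ι φ =ᵐ[volume] φ.toTestFunction := by
  rw [zeroExtension, hι φ]
  conv_rhs => rw [← φ.indicator_toTestFunction]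
  exact indicator_ae_eq_of_restrict (MemLp.coeFn_toLp _)

/-- Along a subsequence, convergence in `D_0^{s,p}(Ω)` implies convergence almost everywhere. -/
theorem exists_subseq_tendsto_zeroExtension {u : ℕ → HomogeneousSobolev hs hp Ω}
    {v : HomogeneousSobolev hs hp Ω} (h : Tendsto u atTop (𝓝 v)) :
    ∃ ns : ℕ → ℕ, StrictMono ns ∧
      ∀ᵐ x, Tendsto (fun n => zeroExtension ι (u (ns n)) x) atTop (𝓝 (zeroExtension ι v x)) := by
  have h1 : Tendsto (fun n => ι (u n)) atTop (𝓝 (ι v)) := (ι.continuous.tendsto v).comp h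
  obtain ⟨ns, hns, hae⟩ := (tendstoInMeasure_of_tendsto_Lp h1).exists_seq_tendsto_ae
  refine ⟨ns, hns, ?_⟩
  filter_upwards [(ae_restrict_iff' Ω.isOpen.measurableSet).1 hae] with x hx
  by_cases hxΩ : x ∈ (Ω : Set (EuclideanSpace ℝ (Fin N)))
  · simpa [zeroExtension, hxΩ] using hx hxΩ
  · simp [zeroExtension, hxΩ]

/-- Every element of `D_0^{s,p}(Ω)` is the limit, both in norm and almost everywhere, of a sequence
of test functions. -/
theorem exists_seq_testFunction (hι : IsL1Embedding ι) (u : HomogeneousSobolev hs hp Ω) :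
    ∃ φ : ℕ → GagliardoTestSpace hs hp Ω,
      Tendsto (fun n => (φ n : HomogeneousSobolev hs hp Ω)) atTop (𝓝 u) ∧
      ∀ᵐ x, Tendsto (fun n => (φ n).toTestFunction x) atTop (𝓝 (zeroExtension ι u x)) := by
  obtain ⟨x, hx, hxu⟩ := mem_closure_iff_seq_limit.1
    ((UniformSpace.Completion.denseRange_coe (α := GagliardoTestSpace hs hp Ω)) u)
  choose φ hφ using hx
  obtain rfl : (fun n => (φ n : HomogeneousSobolev hs hp Ω)) = x := funext hφ
  obtain ⟨ns, hns, hae⟩ := exists_subseq_tendsto_zeroExtension (ι := ι) hxu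
  refine ⟨fun n => φ (ns n), hxu.comp hns.tendsto_atTop, ?_⟩
  filter_upwards [hae, ae_all_iff.2 fun n => zeroExtension_coe hι (φ (ns n))] with x hx hx'
  simpa only [hx'] using hx

/-- Test functions have the same mutual distances in `D_0^{s,p}(Ω)` as their difference quotients in
`L^p`. -/
theorem GagliardoTestSpace.dist_toLp_gagliardoQuotient [Fact (1 ≤ ENNReal.ofReal p)]
    (φ ψ : GagliardoTestSpace hs hp Ω) :
    dist ((memLp_gagliardoQuotient hs hp φ.toTestFunction).toLp)
      ((memLp_gagliardoQuotient hs hp ψ.toTestFunction).toLp) =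
      dist (φ : HomogeneousSobolev hs hp Ω) ψ := by
  rw [UniformSpace.Completion.dist_eq, dist_eq_norm, dist_eq_norm, ← MemLp.toLp_sub, Lp.norm_toLp,
    ← gagliardoQuotient_sub]
  exact (congrArg ENNReal.toReal (φ - ψ).eLpNorm_gagliardoQuotient).trans (toReal_enorm _)

/-- The quotients of an approximating sequence of test functions converge in `L^p`, and the norm of
the limit is the norm in the completion. -/
theorem tendsto_eLpNorm_sub_and_eLpNorm_eq (u : HomogeneousSobolev hs hp Ω)
    (v : EuclideanSpace ℝ (Fin N) → ℝ) (φ : ℕ → GagliardoTestSpace hs hp Ω)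
    (h1 : Tendsto (fun n => (φ n : HomogeneousSobolev hs hp Ω)) atTop (𝓝 u))
    (h2 : ∀ᵐ x, Tendsto (fun n => (φ n).toTestFunction x) atTop (𝓝 (v x))) :
    MemLp (gagliardoQuotient s p v) (ENNReal.ofReal p) ∧
    Tendsto (fun n => eLpNorm (gagliardoQuotient s p (φ n).toTestFunction -
      gagliardoQuotient s p v) (ENNReal.ofReal p)) atTop (𝓝 0) ∧
    eLpNorm (gagliardoQuotient s p v) (ENNReal.ofReal p) = ‖u‖ₑ := by
  have : Fact (1 ≤ ENNReal.ofReal p) := ⟨by simpa using hp.le⟩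
  set q : ℕ → Lp ℝ (ENNReal.ofReal p)
    (volume : Measure (EuclideanSpace ℝ (Fin N) × EuclideanSpace ℝ (Fin N))) :=
    fun n => (memLp_gagliardoQuotient hs hp (φ n).toTestFunction).toLp with hq
  have hc : CauchySeq q := by
    rw [Metric.cauchySeq_iff]
    simp only [hq, GagliardoTestSpace.dist_toLp_gagliardoQuotient]
    exact Metric.cauchySeq_iff.1 h1.cauchySeq
  obtain ⟨g, hg⟩ := cauchySeq_tendsto_of_complete hc
  obtain ⟨ns, hns, hae⟩ := (tendstoInMeasure_of_tendsto_Lp hg).exists_seq_tendsto_ae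
  have hgv : g =ᵐ[volume] gagliardoQuotient s p v := by
    filter_upwards [hae, tendsto_gagliardoQuotient_ae (s := s) (p := p) h2,
      ae_all_iff.2 fun n => MemLp.coeFn_toLp
        (memLp_gagliardoQuotient hs hp (φ (ns n)).toTestFunction)] with z h3 h4 h5
    refine tendsto_nhds_unique h3 ?_
    simp only [hq, h5]
    exact h4.comp hns.tendsto_atTop
  have hmem : MemLp (gagliardoQuotient s p v) (ENNReal.ofReal p) := (memLp_congr_ae hgv).1 (Lp.memLp g)
  refine ⟨hmem, ?_, ?_⟩
  · have h3 := (Lp.tendsto_Lp_iff_tendsto_eLpNorm' q g).1 hg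
    refine h3.congr fun n => eLpNorm_congr_ae ?_
    exact (MemLp.coeFn_toLp _).sub hgv
  · rw [← eLpNorm_congr_ae hgv, ← Lp.enorm_def]
    refine tendsto_nhds_unique ((continuous_enorm.tendsto g).comp hg) ?_
    refine ((continuous_enorm.tendsto u).comp h1).congr fun n => ?_
    simp only [Function.comp_def, hq, Lp.enorm_toLp,
      GagliardoTestSpace.eLpNorm_gagliardoQuotient]
    rw [← ofReal_norm, ← ofReal_norm, UniformSpace.Completion.norm_coe]

theorem memLp_gagliardoQuotient_zeroExtension (hι : IsL1Embedding ι)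
    (u : HomogeneousSobolev hs hp Ω) :
    MemLp (gagliardoQuotient s p (zeroExtension ι u)) (ENNReal.ofReal p) := by
  obtain ⟨φ, h1, h2⟩ := exists_seq_testFunction hι u
  exact (tendsto_eLpNorm_sub_and_eLpNorm_eq u _ φ h1 h2).1

theorem eLpNorm_gagliardoQuotient_zeroExtension (hι : IsL1Embedding ι)
    (u : HomogeneousSobolev hs hp Ω) :
    eLpNorm (gagliardoQuotient s p (zeroExtension ι u)) (ENNReal.ofReal p) = ‖u‖ₑ := by
  obtain ⟨φ, h1, h2⟩ := exists_seq_testFunction hι u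
  exact (tendsto_eLpNorm_sub_and_eLpNorm_eq u _ φ h1 h2).2.2

/-- The norm of the completion is the Gagliardo seminorm of the represented function. -/
theorem gagliardoEnergy_zeroExtension (hι : IsL1Embedding ι) (u : HomogeneousSobolev hs hp Ω) :
    gagliardoEnergy s p (zeroExtension ι u) = ENNReal.ofReal (‖u‖ ^ p) := by
  rw [gagliardoEnergy_eq_eLpNorm hp, eLpNorm_gagliardoQuotient_zeroExtension hι, ← ofReal_norm,
    ENNReal.ofReal_rpow_of_nonneg (norm_nonneg _) (by linarith)]

theorem torsionFunctional_eq (hι : IsL1Embedding ι) (u : HomogeneousSobolev hs hp Ω) :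
    torsionFunctional ι u = 1 / p * ‖u‖ ^ p - ∫ x, zeroExtension ι u x := by
  rw [torsionFunctional, integral_zeroExtension, ← zeroExtension,
    gagliardoEnergy_zeroExtension hι, ENNReal.toReal_ofReal (by positivity)]

theorem integrable_abs_gagliardoQuotient_rpow (hι : IsL1Embedding ι)
    (u : HomogeneousSobolev hs hp Ω) :
    Integrable fun z => |gagliardoQuotient s p (zeroExtension ι u) z| ^ p := by
  have h := (memLp_gagliardoQuotient_zeroExtension hι u).integrable_norm_rpow
    (by simpa using by linarith) ENNReal.ofReal_ne_top
  simpa only [ENNReal.toReal_ofReal (show (0 : ℝ) ≤ p by linarith), Real.norm_eq_abs] using h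

theorem norm_rpow_eq_integral (hι : IsL1Embedding ι) (u : HomogeneousSobolev hs hp Ω) :
    ‖u‖ ^ p = ∫ z, |gagliardoQuotient s p (zeroExtension ι u) z| ^ p := by
  have hp0 : 0 < p := by linarith
  have h := (memLp_gagliardoQuotient_zeroExtension hι u).eLpNorm_eq_integral_rpow_norm
    (by simpa using hp0) ENNReal.ofReal_ne_top
  rw [eLpNorm_gagliardoQuotient_zeroExtension hι, ENNReal.toReal_ofReal hp0.le,
    ← ofReal_norm, ENNReal.ofReal_eq_ofReal_iff (norm_nonneg _) (by positivity)] at h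
  rw [h, Real.rpow_inv_rpow (by positivity) hp0.ne']
  rfl

end Representation

/-! ### Uniform convexity and the minimum problem -/

section UniformConvexity

/-- The defect of convexity of `|·| ^ p` at the midpoint is positive off the diagonal. -/
theorem abs_midpoint_rpow_lt {p : ℝ} (hp : 1 < p) {a b : ℝ} (hab : a ≠ b) :
    |(a + b) / 2| ^ p < (|a| ^ p + |b| ^ p) / 2 := by
  have hp0 : 0 < p := by linarith
  have h1 : |(a + b) / 2| ≤ (|a| + |b|) / 2 := by
    rw [abs_div, abs_two]
    have := abs_add_le a b
    linarith
  rcases eq_or_ne |a| |b| with h | h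
  · -- here `b = -a`, so that the midpoint is `0`
    have hb : a = -b := (abs_eq_abs.1 h).resolve_left hab
    have hb0 : b ≠ 0 := by
      rintro rfl
      simp [hb] at hab
    have : 0 < |b| ^ p := Real.rpow_pos_of_pos (abs_pos.2 hb0) _
    rw [hb]
    simpa [Real.zero_rpow hp0.ne'] using this
  · have h2 := (strictConvexOn_rpow hp).2 (abs_nonneg a) (abs_nonneg b) h
      (show (0 : ℝ) < 1 / 2 by norm_num) (show (0 : ℝ) < 1 / 2 by norm_num) (by norm_num)
    simp only [smul_eq_mul] at h2
    calc |(a + b) / 2| ^ p ≤ ((|a| + |b|) / 2) ^ p := by gcongr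
      _ = (1 / 2 * |a| + 1 / 2 * |b|) ^ p := by ring_nf
      _ < _ := h2
      _ = _ := by ring

/-- A pointwise form of the uniform convexity of `L^p`, by compactness and homogeneity. -/
theorem exists_abs_sub_rpow_le {p : ℝ} (hp : 1 < p) {ε : ℝ} (hε : 0 < ε) :
    ∃ C : ℝ, 0 ≤ C ∧ ∀ a b : ℝ, |a - b| ^ p ≤ ε * (|a| ^ p + |b| ^ p) +
      C * ((|a| ^ p + |b| ^ p) / 2 - |(a + b) / 2| ^ p) := by
  have hp0 : 0 < p := by linarith
  have hdef : ∀ a b : ℝ, 0 ≤ (|a| ^ p + |b| ^ p) / 2 - |(a + b) / 2| ^ p := by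
    intro a b
    rcases eq_or_ne a b with rfl | h
    · simp
    · exact sub_nonneg.2 (abs_midpoint_rpow_lt hp h).le
  set K : Set (ℝ × ℝ) := {z | |z.1| ^ p + |z.2| ^ p = 1 ∧ ε ≤ |z.1 - z.2| ^ p} with hK
  have hc : ∀ {f : ℝ × ℝ → ℝ}, Continuous f → Continuous fun z => |f z| ^ p :=
    fun hf => hf.abs.rpow_const fun _ => Or.inr hp0.le
  have hKc : IsCompact K := by
    refine Metric.isCompact_of_isClosed_isBounded ?_ ?_
    · exact (isClosed_eq ((hc continuous_fst).add (hc continuous_snd)) continuous_const).inter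
        (isClosed_le continuous_const (hc (continuous_fst.sub continuous_snd)))
    · refine (Metric.isBounded_closedBall (x := (0 : ℝ × ℝ)) (r := 1)).subset fun z hz => ?_
      have h1 : ∀ t : ℝ, |t| ^ p ≤ 1 → |t| ≤ 1 := fun t ht => by
        by_contra! h
        exact absurd ht (not_le.2 (Real.one_lt_rpow h hp0))
      have ha : 0 ≤ |z.1| ^ p := by positivity
      have hb : 0 ≤ |z.2| ^ p := by positivity
      have := hz.1
      simp only [mem_closedBall_zero_iff, Prod.norm_def, Real.norm_eq_abs, max_le_iff]
      exact ⟨h1 _ (by linarith), h1 _ (by linarith)⟩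
  have hcont : Continuous fun z : ℝ × ℝ =>
      (|z.1| ^ p + |z.2| ^ p) / 2 - |(z.1 + z.2) / 2| ^ p :=
    (((hc continuous_fst).add (hc continuous_snd)).div_const 2).sub
      (hc ((continuous_fst.add continuous_snd).div_const 2))
  obtain ⟨δ, hδ, hδK⟩ : ∃ δ > 0, ∀ z ∈ K,
      δ ≤ (|z.1| ^ p + |z.2| ^ p) / 2 - |(z.1 + z.2) / 2| ^ p := by
    rcases K.eq_empty_or_nonempty with h | h
    · exact ⟨1, one_pos, by simp [h]⟩
    · obtain ⟨z, hz, hmin⟩ := hKc.exists_isMinOn h hcont.continuousOn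
      refine ⟨_, sub_pos.2 (abs_midpoint_rpow_lt hp (a := z.1) (b := z.2) ?_), hmin⟩
      intro h
      have := hz.2
      rw [h, sub_self, abs_zero, Real.zero_rpow hp0.ne'] at this
      linarith
  refine ⟨2 ^ p / δ, by positivity, fun a b => ?_⟩
  set m := |a| ^ p + |b| ^ p with hm
  have ha : 0 ≤ |a| ^ p := by positivity
  have hb : 0 ≤ |b| ^ p := by positivity
  have hm0 : 0 ≤ m := add_nonneg ha hb
  have hnn : 0 ≤ 2 ^ p / δ * (m / 2 - |(a + b) / 2| ^ p) :=
    mul_nonneg (by positivity) (hdef a b)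
  rcases hm0.eq_or_lt with h0 | hmpos
  · have ha' : a = 0 := by
      have : |a| ^ p = 0 := by linarith
      rw [Real.rpow_eq_zero (abs_nonneg _) hp0.ne'] at this
      exact abs_eq_zero.1 this
    have hb' : b = 0 := by
      have : |b| ^ p = 0 := by linarith
      rw [Real.rpow_eq_zero (abs_nonneg _) hp0.ne'] at this
      exact abs_eq_zero.1 this
    have h1 : |a - b| ^ p = 0 := by rw [ha', hb', sub_self, abs_zero, Real.zero_rpow hp0.ne']
    rw [h1]
    exact add_nonneg (by positivity) hnn
  by_cases hsmall : |a - b| ^ p ≤ ε * m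
  · linarith
  push Not at hsmall
  -- rescale to the compact set `K`
  set t := m ^ (1 / p) with ht
  have htpos : 0 < t := Real.rpow_pos_of_pos hmpos _
  have htp : t ^ p = m := by
    rw [ht, ← Real.rpow_mul hm0, one_div, inv_mul_cancel₀ hp0.ne', Real.rpow_one]
  have hsc : ∀ x : ℝ, |x / t| ^ p = |x| ^ p / m := fun x => by
    rw [abs_div, abs_of_pos htpos, Real.div_rpow (abs_nonneg _) htpos.le, htp]
  have hz : ((a / t, b / t) : ℝ × ℝ) ∈ K := by
    refine ⟨?_, ?_⟩
    · dsimp only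
      rw [hsc, hsc, ← add_div, ← hm, div_self hmpos.ne']
    · dsimp only
      rw [← sub_div, hsc, le_div_iff₀ hmpos]
      exact hsmall.le
  have h1 := hδK _ hz
  dsimp only at h1
  rw [show (a / t + b / t) / 2 = ((a + b) / 2) / t by ring, hsc, hsc, hsc] at h1
  have h2 : δ * m ≤ m / 2 - |(a + b) / 2| ^ p := by
    rw [← add_div, ← hm, div_right_comm, ← sub_div, le_div_iff₀ hmpos] at h1
    exact h1
  have h3 : |a - b| ^ p ≤ 2 ^ p * m := by
    have hmax : |a - b| ≤ 2 * max |a| |b| := by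
      have := abs_sub a b
      have h4 := le_max_left |a| |b|
      have h5 := le_max_right |a| |b|
      linarith
    calc |a - b| ^ p ≤ (2 * max |a| |b|) ^ p := by gcongr
      _ = 2 ^ p * (max |a| |b|) ^ p := Real.mul_rpow (by norm_num) (by positivity)
      _ ≤ 2 ^ p * m := by
        gcongr
        rcases max_choice |a| |b| with h | h <;> rw [h] <;> linarith
  have h4 : 2 ^ p * m ≤ 2 ^ p / δ * (m / 2 - |(a + b) / 2| ^ p) := by
    calc 2 ^ p * m = 2 ^ p / δ * (δ * m) := by field_simp
      _ ≤ _ := by gcongr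
  have : 0 ≤ ε * m := by positivity
  linarith

/-- If the norm of a complete space is uniformly convex in the sense of `exists_abs_sub_rpow_le`,
then minimizing sequences of `u ↦ ‖u‖ ^ p / p - ℓ u` are Cauchy, and the minimum is attained exactly
once. -/
theorem existsUnique_minimizer {X : Type*} [NormedAddCommGroup X] [NormedSpace ℝ X]
    [CompleteSpace X] {p : ℝ} (hp : 1 < p)
    (huc : ∀ ε > 0, ∃ C : ℝ, 0 ≤ C ∧ ∀ u v : X, ‖u - v‖ ^ p ≤ ε * (‖u‖ ^ p + ‖v‖ ^ p) +
      C * ((‖u‖ ^ p + ‖v‖ ^ p) / 2 - ‖(2⁻¹ : ℝ) • (u + v)‖ ^ p))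
    (ℓ : X →L[ℝ] ℝ) :
    ∃! w : X, ∀ u : X, 1 / p * ‖w‖ ^ p - ℓ w ≤ 1 / p * ‖u‖ ^ p - ℓ u := by
  have hp0 : 0 < p := by linarith
  set F : X → ℝ := fun u => 1 / p * ‖u‖ ^ p - ℓ u with hF
  -- coercivity, by Young's inequality
  obtain ⟨A, hA⟩ : ∃ A : ℝ, ∀ u : X, ‖u‖ ^ p ≤ 2 * p * (F u + A) := by
    set q := p.conjExponent
    have hpq : p.HolderConjugate q := Real.HolderConjugate.conjExponent hp
    set c : ℝ := 2 ^ (1 / p)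
    have hc : 0 < c := by positivity
    have hcp : c ^ p = 2 := by
      rw [← Real.rpow_mul (by norm_num), one_div, inv_mul_cancel₀ hp0.ne', Real.rpow_one]
    refine ⟨(c * ‖ℓ‖) ^ q / q, fun u => ?_⟩
    have h1 := Real.young_inequality_of_nonneg (a := ‖u‖ / c) (b := c * ‖ℓ‖)
      (by positivity) (by positivity) hpq
    rw [Real.div_rpow (norm_nonneg _) hc.le, hcp] at h1
    have h2 : ℓ u ≤ ‖u‖ / c * (c * ‖ℓ‖) := by
      refine (le_abs_self _).trans ((ℓ.le_opNorm u).trans (le_of_eq ?_))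
      field_simp
    have h3 : 2 * p * (F u + (c * ‖ℓ‖) ^ q / q) - ‖u‖ ^ p =
        2 * p * (‖u‖ ^ p / 2 / p + (c * ‖ℓ‖) ^ q / q - ℓ u) := by
      simp only [hF]
      field_simp
      ring
    have h4 : 0 ≤ 2 * p * (‖u‖ ^ p / 2 / p + (c * ‖ℓ‖) ^ q / q - ℓ u) :=
      mul_nonneg (by positivity) (by linarith)
    linarith
  have hbdd : BddBelow (range F) := by
    refine ⟨-A, ?_⟩
    rintro _ ⟨u, rfl⟩
    have h1 : 0 ≤ 2 * p * (F u + A) := (by positivity : (0 : ℝ) ≤ ‖u‖ ^ p).trans (hA u)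
    have := nonneg_of_mul_nonneg_right h1 (by positivity)
    linarith
  set m := sInf (range F) with hm
  have hmle : ∀ u, m ≤ F u := fun u => csInf_le hbdd ⟨u, rfl⟩
  -- two almost minimizers are close to each other
  have hkey : ∀ η > 0, ∃ δ > 0, ∀ u v : X, F u ≤ m + δ → F v ≤ m + δ → ‖u - v‖ ^ p ≤ η := by
    intro η hη
    set R := 2 * p * (m + 1 + A)
    have hR : ∀ u, F u ≤ m + 1 → ‖u‖ ^ p ≤ R := fun u hu =>
      (hA u).trans (mul_le_mul_of_nonneg_left (by linarith) (by positivity))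
    have hR0 : 0 ≤ |R| := abs_nonneg _
    obtain ⟨C, hC0, hC⟩ := huc (η / (4 * (|R| + 1))) (by positivity)
    refine ⟨min 1 (η / (2 * (C * p + 1))), by positivity, fun u v hu hv => ?_⟩
    set δ := min 1 (η / (2 * (C * p + 1)))
    have hδ1 : δ ≤ 1 := min_le_left _ _
    have hδ2 : δ ≤ η / (2 * (C * p + 1)) := min_le_right _ _
    have hu' := hR u (by linarith)
    have hv' := hR v (by linarith)
    have hRabs := le_abs_self R
    have hmid : (‖u‖ ^ p + ‖v‖ ^ p) / 2 - ‖(2⁻¹ : ℝ) • (u + v)‖ ^ p ≤ p * δ := by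
      have h1 := hmle ((2⁻¹ : ℝ) • (u + v))
      have h2 : (‖u‖ ^ p + ‖v‖ ^ p) / 2 - ‖(2⁻¹ : ℝ) • (u + v)‖ ^ p =
          p * ((F u + F v) / 2 - F ((2⁻¹ : ℝ) • (u + v))) := by
        simp only [hF, map_smul, map_add, smul_eq_mul]
        field_simp
        ring
      rw [h2]
      exact mul_le_mul_of_nonneg_left (by linarith) hp0.le
    have h1 : η / (4 * (|R| + 1)) * (‖u‖ ^ p + ‖v‖ ^ p) ≤ η / 2 := by
      calc η / (4 * (|R| + 1)) * (‖u‖ ^ p + ‖v‖ ^ p)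
          ≤ η / (4 * (|R| + 1)) * (2 * (|R| + 1)) := by
            gcongr
            linarith
        _ = η / 2 := by
            field_simp
            ring
    have h2 : C * ((‖u‖ ^ p + ‖v‖ ^ p) / 2 - ‖(2⁻¹ : ℝ) • (u + v)‖ ^ p) ≤ η / 2 := by
      calc _ ≤ C * (p * δ) := by gcongr
        _ ≤ C * (p * (η / (2 * (C * p + 1)))) := by gcongr
        _ = η / 2 * (C * p / (C * p + 1)) := by field_simp
        _ ≤ η / 2 * 1 := by
            gcongr
            rw [div_le_one (by positivity)]
            linarith
        _ = η / 2 := mul_one _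
    linarith [hC u v]
  have hFc : Continuous F :=
    (continuous_const.mul (continuous_norm.rpow_const fun _ => Or.inr hp0.le)).sub ℓ.continuous
  have huniq : ∀ u v : X, F u ≤ m → F v ≤ m → u = v := by
    intro u v hu hv
    have h0 : ‖u - v‖ ^ p ≤ 0 := by
      refine le_of_forall_pos_le_add fun η hη => ?_
      obtain ⟨δ, hδ, h⟩ := hkey η hη
      simpa using h u v (by linarith) (by linarith)
    have h1 : ‖u - v‖ ^ p = 0 := le_antisymm h0 (by positivity)
    rw [Real.rpow_eq_zero (norm_nonneg _) hp0.ne'] at h1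
    exact sub_eq_zero.1 (norm_eq_zero.1 h1)
  obtain ⟨f, -, hf, hfr⟩ := exists_seq_tendsto_sInf (range_nonempty F) hbdd
  choose u hu using hfr
  obtain rfl : (fun n => F (u n)) = f := funext hu
  have hcauchy : CauchySeq u := by
    rw [Metric.cauchySeq_iff]
    intro ε hε
    obtain ⟨δ, hδ, h⟩ := hkey ((ε / 2) ^ p) (by positivity)
    obtain ⟨n₀, hn₀⟩ := eventually_atTop.1 (hf.eventually_le_const (show m < m + δ by linarith))
    refine ⟨n₀, fun k hk n hn => ?_⟩
    rw [dist_eq_norm]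
    have := (Real.rpow_le_rpow_iff (norm_nonneg _) (by positivity) hp0).1
      (h (u k) (u n) (hn₀ k hk) (hn₀ n hn))
    linarith
  obtain ⟨w, hw⟩ := cauchySeq_tendsto_of_complete hcauchy
  have hFw : F w = m := tendsto_nhds_unique ((hFc.tendsto w).comp hw) hf
  refine ⟨w, fun v => hFw.trans_le (hmle v), fun v hv => huniq v w ?_ hFw.le⟩
  exact (hv w).trans hFw.le

variable {N : ℕ} {s p : ℝ} {hs : s ∈ Ioo (0 : ℝ) 1} {hp : 1 < p}
  {Ω : Opens (EuclideanSpace ℝ (Fin N))}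
  {ι : HomogeneousSobolev hs hp Ω →L[ℝ]
      Lp ℝ 1 (volume.restrict (Ω : Set (EuclideanSpace ℝ (Fin N))))}

theorem homogeneousSobolev_uniformlyConvex (hι : IsL1Embedding ι) {ε : ℝ} (hε : 0 < ε) :
    ∃ C : ℝ, 0 ≤ C ∧ ∀ u v : HomogeneousSobolev hs hp Ω,
      ‖u - v‖ ^ p ≤ ε * (‖u‖ ^ p + ‖v‖ ^ p) +
        C * ((‖u‖ ^ p + ‖v‖ ^ p) / 2 - ‖(2⁻¹ : ℝ) • (u + v)‖ ^ p) := by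
  obtain ⟨C, hC0, hC⟩ := exists_abs_sub_rpow_le hp hε
  refine ⟨C, hC0, fun u v => ?_⟩
  have iu := integrable_abs_gagliardoQuotient_rpow hι u
  have iv := integrable_abs_gagliardoQuotient_rpow hι v
  have im := integrable_abs_gagliardoQuotient_rpow hι ((2⁻¹ : ℝ) • (u + v))
  have hsub := gagliardoQuotient_congr_ae (s := s) (p := p) (zeroExtension_sub (ι := ι) u v)
  have hmid := gagliardoQuotient_congr_ae (s := s) (p := p)
    ((zeroExtension_smul (ι := ι) (2⁻¹ : ℝ) (u + v)).trans
      ((zeroExtension_add (ι := ι) u v).const_smul (2⁻¹ : ℝ)))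
  rw [gagliardoQuotient_sub] at hsub
  rw [gagliardoQuotient_smul, gagliardoQuotient_add] at hmid
  have iuv : Integrable fun z => |gagliardoQuotient s p (zeroExtension ι u) z| ^ p +
    |gagliardoQuotient s p (zeroExtension ι v) z| ^ p := iu.add iv
  have idef : Integrable fun z => (|gagliardoQuotient s p (zeroExtension ι u) z| ^ p +
    |gagliardoQuotient s p (zeroExtension ι v) z| ^ p) / 2 -
    |gagliardoQuotient s p (zeroExtension ι ((2⁻¹ : ℝ) • (u + v))) z| ^ p :=
    (iuv.div_const 2).sub im
  rw [norm_rpow_eq_integral hι u, norm_rpow_eq_integral hι v, norm_rpow_eq_integral hι (u - v),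
    norm_rpow_eq_integral hι ((2⁻¹ : ℝ) • (u + v)), ← integral_add iu iv, ← integral_div,
    ← integral_sub (iuv.div_const 2) im, ← integral_const_mul, ← integral_const_mul,
    ← integral_add (iuv.const_mul ε) (idef.const_mul C)]
  refine integral_mono_ae (integrable_abs_gagliardoQuotient_rpow hι _)
    ((iuv.const_mul ε).add (idef.const_mul C)) ?_
  filter_upwards [hsub, hmid] with z h1 h2
  simp only [h1, h2, Pi.sub_apply, Pi.smul_apply, Pi.add_apply, smul_eq_mul]
  have := hC (gagliardoQuotient s p (zeroExtension ι u) z)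
    (gagliardoQuotient s p (zeroExtension ι v) z)
  simpa only [div_eq_inv_mul] using this

/-- The linear functional `u ↦ ∫ u` on `D_0^{s,p}(Ω)`, bounded since the embedding into `L^1(Ω)`
is. -/
noncomputable def integralFunctional
    (ι : HomogeneousSobolev hs hp Ω →L[ℝ]
      Lp ℝ 1 (volume.restrict (Ω : Set (EuclideanSpace ℝ (Fin N))))) :
    HomogeneousSobolev hs hp Ω →L[ℝ] ℝ :=
  (L1.integralCLM' ℝ).comp ι

theorem integralFunctional_apply (u : HomogeneousSobolev hs hp Ω) :
    integralFunctional ι u = ∫ x, zeroExtension ι u x := by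
  rw [integral_zeroExtension, ← L1.integral_eq_integral]
  exact (L1.integral_eq _).symm

theorem existsUnique_isTorsionFunction (hι : IsL1Embedding ι) :
    ∃! w : HomogeneousSobolev hs hp Ω, IsTorsionFunction ι w := by
  have h := existsUnique_minimizer hp
    (fun ε hε => homogeneousSobolev_uniformlyConvex hι hε) (integralFunctional ι)
  simpa only [IsTorsionFunction, torsionFunctional_eq hι, integralFunctional_apply] using h

end UniformConvexity

/-! ### Truncations and the energy estimate -/

section Truncation

/-- Dominated convergence in `L^p` with a convergent sequence of dominating functions. -/
theorem tendsto_eLpNorm_sub_of_dominated {α : Type*} [MeasurableSpace α] {μ : Measure α}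
    {r : ℝ≥0∞} (hr : 1 ≤ r) (hr' : r ≠ ∞) {f h : ℕ → α → ℝ} {g k : α → ℝ}
    (hf : ∀ n, MemLp (f n) r μ) (hg : MemLp g r μ)
    (hfg : Tendsto (fun n => eLpNorm (f n - g) r μ) atTop (𝓝 0))
    (hh : ∀ n, AEStronglyMeasurable (h n) μ) (hk : MemLp k r μ)
    (hle : ∀ n x, |h n x| ≤ |f n x|)
    (hhk : ∀ᵐ x ∂μ, Tendsto (fun n => h n x) atTop (𝓝 (k x))) :
    Tendsto (fun n => eLpNorm (h n - k) r μ) atTop (𝓝 0) := by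
  obtain ⟨-, hui, hut⟩ := (tendstoInMeasure_iff_tendsto_Lp hr hr' hf hg).2 hfg
  have hmono : ∀ n (A : Set α), eLpNorm (A.indicator (h n)) r μ ≤
      eLpNorm (A.indicator (f n)) r μ := by
    refine fun n A => eLpNorm_mono fun x => ?_
    rw [norm_indicator_eq_indicator_norm, norm_indicator_eq_indicator_norm]
    exact indicator_le_indicator (hle n x)
  refine tendsto_Lp_of_tendsto_ae hr hr' hh hk ?_ ?_ hhk
  · intro ε hε
    obtain ⟨δ, hδ, H⟩ := hui hε
    exact ⟨δ, hδ, fun n A hA hA' => (hmono n A).trans (H n A hA hA')⟩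
  · intro ε hε
    obtain ⟨A, hA, H⟩ := hut hε
    exact ⟨A, hA, fun n => (hmono n _).trans (H n)⟩

/-- A smooth approximation of `t ↦ max (t - k) 0` vanishing at `0`. -/
noncomputable def smoothTruncation (k ε t : ℝ) : ℝ :=
  (√((t - k) ^ 2 + ε ^ 2) + (t - k)) / 2 - (√(k ^ 2 + ε ^ 2) - k) / 2

theorem smoothTruncation_zero (k ε : ℝ) : smoothTruncation k ε 0 = 0 := by
  simp only [smoothTruncation, zero_sub, neg_sq]
  ring

theorem contDiff_smoothTruncation (k : ℝ) {ε : ℝ} (hε : ε ≠ 0) {n : WithTop ℕ∞} :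
    ContDiff ℝ n (smoothTruncation k ε) := by
  unfold smoothTruncation
  have h : ContDiff ℝ n fun t : ℝ => √((t - k) ^ 2 + ε ^ 2) :=
    ContDiff.sqrt (by fun_prop) fun t => by positivity
  fun_prop

theorem abs_smoothTruncation_sub_le (k : ℝ) {ε : ℝ} (hε : ε ≠ 0) (a b : ℝ) :
    |smoothTruncation k ε a - smoothTruncation k ε b| ≤ |a - b| := by
  have hsq : ∀ x y : ℝ, |√(x ^ 2 + ε ^ 2) - √(y ^ 2 + ε ^ 2)| ≤ |x - y| := by
    intro x y
    have hX : 0 < √(x ^ 2 + ε ^ 2) := Real.sqrt_pos.2 (by positivity)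
    have hY : 0 < √(y ^ 2 + ε ^ 2) := Real.sqrt_pos.2 (by positivity)
    have h1 : |x| ≤ √(x ^ 2 + ε ^ 2) := Real.abs_le_sqrt (by nlinarith [sq_nonneg ε])
    have h2 : |y| ≤ √(y ^ 2 + ε ^ 2) := Real.abs_le_sqrt (by nlinarith [sq_nonneg ε])
    have h3 : |√(x ^ 2 + ε ^ 2) - √(y ^ 2 + ε ^ 2)| * (√(x ^ 2 + ε ^ 2) + √(y ^ 2 + ε ^ 2)) =
        |x - y| * |x + y| := by
      rw [← abs_of_pos (add_pos hX hY), ← abs_mul, ← abs_mul]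
      congr 1
      have hx := Real.sq_sqrt (show 0 ≤ x ^ 2 + ε ^ 2 by positivity)
      have hy := Real.sq_sqrt (show 0 ≤ y ^ 2 + ε ^ 2 by positivity)
      linear_combination hx - hy
    refine le_of_mul_le_mul_right (h3.le.trans ?_) (add_pos hX hY)
    have := abs_add_le x y
    gcongr
    linarith
  have h1 := hsq (a - k) (b - k)
  rw [sub_sub_sub_cancel_right] at h1
  calc |smoothTruncation k ε a - smoothTruncation k ε b|
      = |(√((a - k) ^ 2 + ε ^ 2) - √((b - k) ^ 2 + ε ^ 2)) + (a - b)| / 2 := by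
        rw [← abs_two (α := ℝ), ← abs_div]
        congr 1
        simp only [smoothTruncation]
        ring
    _ ≤ (|a - b| + |a - b|) / 2 := by
        gcongr
        exact (abs_add_le _ _).trans (by gcongr)
    _ = |a - b| := by ring

theorem tendsto_smoothTruncation {k : ℝ} (hk : 0 ≤ k) (t : ℝ) :
    Tendsto (fun n : ℕ => smoothTruncation k (1 / ((n : ℝ) + 1)) t) atTop (𝓝 (max (t - k) 0)) := by
  have h : Continuous fun ε => smoothTruncation k ε t := by
    unfold smoothTruncation
    fun_prop
  have h0 : smoothTruncation k 0 t = max (t - k) 0 := by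
    simp only [smoothTruncation, zero_pow two_ne_zero, add_zero, Real.sqrt_sq_eq_abs,
      abs_of_nonneg hk, sub_self, zero_div, sub_zero]
    rcases le_total 0 (t - k) with h | h
    · rw [max_eq_left h, abs_of_nonneg h]
      ring
    · rw [max_eq_right h, abs_of_nonpos h]
      ring
  rw [← h0]
  exact (h.tendsto 0).comp tendsto_one_div_add_atTop_nhds_zero_nat

variable {N : ℕ} {s p : ℝ}

theorem abs_gagliardoQuotient_comp_le {g : ℝ → ℝ} (hg : ∀ a b, |g a - g b| ≤ |a - b|)
    (u : EuclideanSpace ℝ (Fin N) → ℝ)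
    (z : EuclideanSpace ℝ (Fin N) × EuclideanSpace ℝ (Fin N)) :
    |gagliardoQuotient s p (fun x => g (u x)) z| ≤ |gagliardoQuotient s p u z| := by
  simp only [gagliardoQuotient, abs_mul]
  exact mul_le_mul_of_nonneg_right (hg _ _) (abs_nonneg _)

variable {hs : s ∈ Ioo (0 : ℝ) 1} {hp : 1 < p} {Ω : Opens (EuclideanSpace ℝ (Fin N))}
  {ι : HomogeneousSobolev hs hp Ω →L[ℝ]
      Lp ℝ 1 (volume.restrict (Ω : Set (EuclideanSpace ℝ (Fin N))))}

/-- Composition of a test function with a smooth function vanishing at `0`. -/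
noncomputable def GagliardoTestSpace.comp (φ : GagliardoTestSpace hs hp Ω) (G : ℝ → ℝ)
    (hG : ContDiff ℝ ((⊤ : ℕ∞) : WithTop ℕ∞) G) (hG0 : G 0 = 0) : GagliardoTestSpace hs hp Ω :=
  (⟨G ∘ φ.toTestFunction, hG.comp φ.toTestFunction.contDiff,
    φ.toTestFunction.hasCompactSupport.comp_left hG0,
    (tsupport_comp_subset hG0 _).trans φ.toTestFunction.tsupport_subset⟩ : 𝓓(Ω, ℝ))

/-- `D_0^{s,p}(Ω)` is stable under the contractions of `ℝ` that are limits of smooth contractions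
vanishing at `0`. -/
theorem exists_zeroExtension_eq_comp (hι : IsL1Embedding ι) (u : HomogeneousSobolev hs hp Ω)
    {G : ℕ → ℝ → ℝ} {g : ℝ → ℝ} (hG : ∀ n, ContDiff ℝ ((⊤ : ℕ∞) : WithTop ℕ∞) (G n))
    (hG0 : ∀ n, G n 0 = 0) (hG1 : ∀ n a b, |G n a - G n b| ≤ |a - b|)
    (hGg : ∀ t, Tendsto (fun n => G n t) atTop (𝓝 (g t))) :
    ∃ v : HomogeneousSobolev hs hp Ω,
      zeroExtension ι v =ᵐ[volume] fun x => g (zeroExtension ι u x) := by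
  have : Fact (1 ≤ ENNReal.ofReal p) := ⟨by simpa using hp.le⟩
  have hg1 : ∀ a b, |g a - g b| ≤ |a - b| := fun a b =>
    le_of_tendsto ((hGg a).sub (hGg b)).abs (Eventually.of_forall fun n => hG1 n a b)
  have hgc : Continuous g :=
    (LipschitzWith.of_dist_le_mul (K := 1) fun a b => by
      simpa [Real.dist_eq] using hg1 a b).continuous
  obtain ⟨φ, hφ, hφae⟩ := exists_seq_testFunction hι u
  obtain ⟨hmem, hconv, -⟩ := tendsto_eLpNorm_sub_and_eLpNorm_eq u _ φ hφ hφae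
  set ψ : ℕ → GagliardoTestSpace hs hp Ω := fun n => (φ n).comp (G n) (hG n) (hG0 n)
  have hψ : ∀ n x, (ψ n).toTestFunction x = G n ((φ n).toTestFunction x) := fun _ _ => rfl
  have hψae : ∀ᵐ x, Tendsto (fun n => (ψ n).toTestFunction x) atTop
      (𝓝 (g (zeroExtension ι u x))) := by
    filter_upwards [hφae] with x hx
    simp only [hψ]
    have h1 : Tendsto (fun n => G n ((φ n).toTestFunction x) - G n (zeroExtension ι u x)) atTop
        (𝓝 0) := by
      refine squeeze_zero_norm (fun n => hG1 n _ _) ?_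
      simpa using (hx.sub_const (zeroExtension ι u x)).abs
    simpa using h1.add (hGg (zeroExtension ι u x))
  have hk : MemLp (gagliardoQuotient s p fun x => g (zeroExtension ι u x)) (ENNReal.ofReal p) :=
    hmem.mono (measurable_gagliardoQuotient
      (hgc.measurable.comp (measurable_zeroExtension u))).aestronglyMeasurable
      (ae_of_all _ fun z => abs_gagliardoQuotient_comp_le hg1 _ z)
  have hlim := tendsto_eLpNorm_sub_of_dominated Fact.out ENNReal.ofReal_ne_top
    (fun n => memLp_gagliardoQuotient hs hp (φ n).toTestFunction) hmem hconv
    (fun n => (memLp_gagliardoQuotient hs hp (ψ n).toTestFunction).1) hk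
    (fun n z => abs_gagliardoQuotient_comp_le (hG1 n) _ z) (tendsto_gagliardoQuotient_ae hψae)
  have hc : CauchySeq fun n => (ψ n : HomogeneousSobolev hs hp Ω) := by
    have h1 := (Lp.tendsto_Lp_iff_tendsto_eLpNorm'' _
      (fun n => memLp_gagliardoQuotient hs hp (ψ n).toTestFunction) _ hk).2 hlim
    have h2 := Metric.cauchySeq_iff.1 h1.cauchySeq
    simp only [GagliardoTestSpace.dist_toLp_gagliardoQuotient] at h2
    exact Metric.cauchySeq_iff.2 h2
  obtain ⟨v, hv⟩ := cauchySeq_tendsto_of_complete hc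
  refine ⟨v, ?_⟩
  obtain ⟨ns, hns, hae⟩ := exists_subseq_tendsto_zeroExtension (ι := ι) hv
  filter_upwards [hae, hψae, ae_all_iff.2 fun n => zeroExtension_coe hι (ψ (ns n))] with x h1 h2 h3
  refine tendsto_nhds_unique h1 ?_
  simp only [h3]
  exact h2.comp hns.tendsto_atTop

theorem exists_zeroExtension_eq_truncation (hι : IsL1Embedding ι) (u : HomogeneousSobolev hs hp Ω)
    {k : ℝ} (hk : 0 ≤ k) :
    ∃ v : HomogeneousSobolev hs hp Ω,
      zeroExtension ι v =ᵐ[volume] fun x => max (zeroExtension ι u x - k) 0 :=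
  exists_zeroExtension_eq_comp hι u (G := fun n => smoothTruncation k (1 / ((n : ℝ) + 1)))
    (g := fun t => max (t - k) 0)
    (fun n => contDiff_smoothTruncation k (by positivity)) (fun n => smoothTruncation_zero _ _)
    (fun n => abs_smoothTruncation_sub_le k (by positivity)) (tendsto_smoothTruncation hk)

/-- The torsion function is nonnegative, since `|w|` is a competitor. -/
theorem IsTorsionFunction.zeroExtension_nonneg (hι : IsL1Embedding ι)
    {w : HomogeneousSobolev hs hp Ω} (hw : IsTorsionFunction ι w) :
    ∀ᵐ x, 0 ≤ zeroExtension ι w x := by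
  have hp0 : 0 < p := by linarith
  obtain ⟨v, hv⟩ := exists_zeroExtension_eq_truncation hι w le_rfl
  set u := (2 : ℝ) • v - w
  have hu : zeroExtension ι u =ᵐ[volume] fun x => |zeroExtension ι w x| := by
    filter_upwards [zeroExtension_sub (ι := ι) ((2 : ℝ) • v) w,
      zeroExtension_smul (ι := ι) (2 : ℝ) v, hv] with x h1 h2 h3
    rw [h1, Pi.sub_apply, h2, Pi.smul_apply, h3, smul_eq_mul, sub_zero]
    rcases le_total 0 (zeroExtension ι w x) with h | h
    · rw [max_eq_left h, abs_of_nonneg h]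
      ring
    · rw [max_eq_right h, abs_of_nonpos h]
      ring
  have hnorm : ‖u‖ ^ p ≤ ‖w‖ ^ p := by
    rw [norm_rpow_eq_integral hι, norm_rpow_eq_integral hι]
    refine integral_mono_ae (integrable_abs_gagliardoQuotient_rpow hι _)
      (integrable_abs_gagliardoQuotient_rpow hι _) ?_
    filter_upwards [gagliardoQuotient_congr_ae (s := s) (p := p) hu] with z hz
    rw [hz]
    refine Real.rpow_le_rpow (abs_nonneg _) ?_ hp0.le
    exact abs_gagliardoQuotient_comp_le abs_abs_sub_abs_le _ z
  have hmin := hw u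
  rw [torsionFunctional_eq hι, torsionFunctional_eq hι] at hmin
  have h1 : 1 / p * ‖u‖ ^ p ≤ 1 / p * ‖w‖ ^ p := by gcongr
  have hint : ∫ x, (|zeroExtension ι w x| - zeroExtension ι w x) ≤ 0 := by
    rw [integral_sub (integrable_zeroExtension w).abs (integrable_zeroExtension w),
      ← integral_congr_ae hu]
    linarith
  have hnn : 0 ≤ fun x => |zeroExtension ι w x| - zeroExtension ι w x := fun x =>
    sub_nonneg.2 (le_abs_self _)
  have h0 := (integral_eq_zero_iff_of_nonneg hnn
    ((integrable_zeroExtension w).abs.sub (integrable_zeroExtension w))).1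
    (le_antisymm hint (integral_nonneg hnn))
  filter_upwards [h0] with x hx
  have : |zeroExtension ι w x| = zeroExtension ι w x := sub_eq_zero.1 hx
  exact abs_eq_self.1 this

/-- The tangent line inequality for `t ↦ t ^ p` at `d - ε e`, for `e` between `0` and `d`. -/
theorem abs_sub_mul_rpow_add_le (hp : 1 < p) {d e ε : ℝ} (hε : ε ∈ Ioo (0 : ℝ) 1)
    (h : 0 ≤ e ∧ e ≤ d ∨ d ≤ e ∧ e ≤ 0) :
    |d - ε * e| ^ p + p * (ε * (1 - ε) ^ (p - 1)) * |e| ^ p ≤ |d| ^ p := by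
  have hp0 : 0 < p := by linarith
  have key : ∀ {d e : ℝ}, 0 ≤ e → e ≤ d →
      |d - ε * e| ^ p + p * (ε * (1 - ε) ^ (p - 1)) * |e| ^ p ≤ |d| ^ p := by
    intro d e he hed
    have hε1 : 0 < 1 - ε := by linarith [hε.2]
    rcases he.eq_or_lt with rfl | hepos
    · simp [Real.zero_rpow hp0.ne']
    have hx1 : (1 - ε) * e ≤ d - ε * e := by linarith
    have hx : 0 < d - ε * e := (mul_pos hε1 hepos).trans_le hx1
    rw [abs_of_pos hx, abs_of_pos hepos, abs_of_pos (hepos.trans_le hed)]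
    have hb := one_add_mul_self_le_rpow_one_add (s := ε * e / (d - ε * e))
      ((by norm_num : (-1 : ℝ) ≤ 0).trans (div_nonneg (mul_pos hε.1 hepos).le hx.le)) hp.le
    have hd : 1 + ε * e / (d - ε * e) = d / (d - ε * e) := by
      field_simp
      ring
    rw [hd, Real.div_rpow (hepos.le.trans hed) hx.le, le_div_iff₀ (by positivity)] at hb
    refine le_trans ?_ hb
    have h1 : (d - ε * e) ^ p = (d - ε * e) ^ (p - 1) * (d - ε * e) := by
      rw [← Real.rpow_add_one hx.ne', sub_add_cancel]
    have h2 : e ^ p = e ^ (p - 1) * e := by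
      rw [← Real.rpow_add_one hepos.ne', sub_add_cancel]
    have h3 : (1 + p * (ε * e / (d - ε * e))) * (d - ε * e) ^ p =
        (d - ε * e) ^ p + p * ε * e * (d - ε * e) ^ (p - 1) := by
      rw [h1]
      field_simp
    rw [h3, h2]
    have h4 : (1 - ε) ^ (p - 1) * e ^ (p - 1) ≤ (d - ε * e) ^ (p - 1) := by
      rw [← Real.mul_rpow hε1.le hepos.le]
      exact Real.rpow_le_rpow (by positivity) hx1 (by linarith)
    have h5 : 0 ≤ p * ε * e := mul_nonneg (mul_nonneg hp0.le hε.1.le) hepos.le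
    nlinarith [mul_le_mul_of_nonneg_left h4 h5]
  rcases h with h | h
  · exact key h.1 h.2
  · have := key (d := -d) (e := -e) (by linarith [h.2]) (by linarith [h.1])
    rwa [show -d - ε * -e = -(d - ε * e) by ring, abs_neg, abs_neg, abs_neg] at this

/-- The Euler--Lagrange equation tested with `(w - k)_+`, as an inequality: it comes from comparing
`w` with `w - ε (w - k)_+` as `ε → 0`. -/
theorem IsTorsionFunction.norm_truncation_rpow_le (hι : IsL1Embedding ι)
    {w v : HomogeneousSobolev hs hp Ω} (hw : IsTorsionFunction ι w) {k : ℝ}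
    (hv : zeroExtension ι v =ᵐ[volume] fun x => max (zeroExtension ι w x - k) 0) :
    ‖v‖ ^ p ≤ ∫ x, zeroExtension ι v x := by
  have hp0 : 0 < p := by linarith
  have key : ∀ ε ∈ Ioo (0 : ℝ) 1, (1 - ε) ^ (p - 1) * ‖v‖ ^ p ≤ ∫ x, zeroExtension ι v x := by
    intro ε hε
    have hext : zeroExtension ι (w - ε • v) =ᵐ[volume]
        zeroExtension ι w - ε • zeroExtension ι v :=
      (zeroExtension_sub w (ε • v)).trans
        ((ae_eq_refl _).sub (zeroExtension_smul ε v))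
    have hq := gagliardoQuotient_congr_ae (s := s) (p := p) hext
    rw [gagliardoQuotient_sub, gagliardoQuotient_smul] at hq
    have hle : ‖w - ε • v‖ ^ p + p * (ε * (1 - ε) ^ (p - 1)) * ‖v‖ ^ p ≤ ‖w‖ ^ p := by
      rw [norm_rpow_eq_integral hι, norm_rpow_eq_integral hι v, norm_rpow_eq_integral hι w,
        ← integral_const_mul, ← integral_add (integrable_abs_gagliardoQuotient_rpow hι _)
          ((integrable_abs_gagliardoQuotient_rpow hι _).const_mul _)]
      refine integral_mono_ae ((integrable_abs_gagliardoQuotient_rpow hι _).add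
          ((integrable_abs_gagliardoQuotient_rpow hι _).const_mul _))
        (integrable_abs_gagliardoQuotient_rpow hι _) ?_
      filter_upwards [hq, gagliardoQuotient_congr_ae (s := s) (p := p) hv] with z h1 h2
      simp only [h1, Pi.sub_apply, Pi.smul_apply, smul_eq_mul]
      refine abs_sub_mul_rpow_add_le hp hε ?_
      rw [h2]
      simp only [gagliardoQuotient]
      have hκ : 0 ≤ ‖z.1 - z.2‖ ^ (-((N + s * p) / p)) := by positivity
      rcases le_total (zeroExtension ι w z.2) (zeroExtension ι w z.1) with h | h
      · left
        have h3 : max (zeroExtension ι w z.2 - k) 0 ≤ max (zeroExtension ι w z.1 - k) 0 :=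
          max_le_max (by linarith) le_rfl
        refine ⟨mul_nonneg (by linarith) hκ, mul_le_mul_of_nonneg_right ?_ hκ⟩
        rcases max_cases (zeroExtension ι w z.2 - k) 0 with h4 | h4 <;>
        rcases max_cases (zeroExtension ι w z.1 - k) 0 with h5 | h5 <;> linarith
      · right
        have h3 : max (zeroExtension ι w z.1 - k) 0 ≤ max (zeroExtension ι w z.2 - k) 0 :=
          max_le_max (by linarith) le_rfl
        refine ⟨mul_le_mul_of_nonneg_right ?_ hκ, mul_nonpos_of_nonpos_of_nonneg (by linarith) hκ⟩
        rcases max_cases (zeroExtension ι w z.2 - k) 0 with h4 | h4 <;>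
        rcases max_cases (zeroExtension ι w z.1 - k) 0 with h5 | h5 <;> linarith
    have hmin := hw (w - ε • v)
    rw [torsionFunctional_eq hι, torsionFunctional_eq hι, integral_congr_ae hext] at hmin
    have hint : ∫ x, (zeroExtension ι w - ε • zeroExtension ι v) x =
        (∫ x, zeroExtension ι w x) - ε * ∫ x, zeroExtension ι v x := by
      simp only [Pi.sub_apply, Pi.smul_apply, smul_eq_mul]
      rw [integral_sub (integrable_zeroExtension w) ((integrable_zeroExtension v).const_mul ε),
        integral_const_mul]
    rw [hint] at hmin
    have h1 : 1 / p * ‖w - ε • v‖ ^ p + ε * ((1 - ε) ^ (p - 1) * ‖v‖ ^ p) ≤ 1 / p * ‖w‖ ^ p := by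
      have := mul_le_mul_of_nonneg_left hle (one_div_pos.2 hp0).le
      refine le_trans (le_of_eq ?_) this
      field_simp
    exact le_of_mul_le_mul_left (by linarith) hε.1
  have hlim : Tendsto (fun ε : ℝ => (1 - ε) ^ (p - 1) * ‖v‖ ^ p) (𝓝[>] 0)
      (𝓝 ((1 - 0) ^ (p - 1) * ‖v‖ ^ p)) := by
    refine Tendsto.mul_const _ (Tendsto.mono_left ?_ nhdsWithin_le_nhds)
    exact ((continuous_const.sub continuous_id).rpow_const
      fun _ => Or.inr (by linarith)).tendsto (0 : ℝ)
  rw [sub_zero, Real.one_rpow, one_mul] at hlim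
  refine le_of_tendsto hlim ?_
  filter_upwards [Ioo_mem_nhdsGT one_pos] with ε hε using key ε hε

end Truncation

/-! ### A fractional Poincaré inequality -/

section FractionalPoincare

variable {N : ℕ} {s p : ℝ}

/-- A fractional Poincaré inequality for functions vanishing off a set `A` of finite measure: around
each point `x` the complement of `A` fills at least half of the ball of measure `2 |A|`, and there
`u x - u y = u x`. -/
theorem exists_lintegral_rpow_le_gagliardoEnergy (hN : 1 ≤ N) (hs : s ∈ Ioo (0 : ℝ) 1)
    (hp : 1 < p) :
    ∃ C : ℝ, 0 < C ∧ ∀ (f : EuclideanSpace ℝ (Fin N) → ℝ) (A : Set (EuclideanSpace ℝ (Fin N))),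
      Measurable f → volume A ≠ ∞ → (∀ x ∉ A, f x = 0) →
      ∫⁻ x, ENNReal.ofReal (|f x| ^ p) ≤
        ENNReal.ofReal C * volume A ^ (s * p / N) * gagliardoEnergy s p f := by
  have hp0 : 0 < p := by linarith
  have hsp : 0 < s * p := mul_pos hs.1 hp0
  have hN0 : (0 : ℝ) < N := by exact_mod_cast hN
  have : Nonempty (Fin N) := ⟨⟨0, hN⟩⟩
  set ω : ℝ := (volume (Metric.ball (0 : EuclideanSpace ℝ (Fin N)) 1)).toReal with hω
  have hωpos : 0 < ω :=
    ENNReal.toReal_pos (Metric.measure_ball_pos _ _ one_pos).ne' measure_ball_lt_top.ne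
  refine ⟨(2 / ω) ^ ((N + s * p) / N), by positivity, fun f A hf hA hfA => ?_⟩
  rcases eq_or_ne (volume A) 0 with hA0 | hA0
  · have h0 : ∫⁻ x, ENNReal.ofReal (|f x| ^ p) = 0 := by
      refine (lintegral_congr_ae ?_).trans lintegral_zero
      filter_upwards [compl_mem_ae_iff.2 hA0] with x hx
      simp [hfA x hx, Real.zero_rpow hp0.ne']
    simp [h0]
  set a := (volume A).toReal with ha
  have hapos : 0 < a := ENNReal.toReal_pos hA0 hA
  have hAa : volume A = ENNReal.ofReal a := (ENNReal.ofReal_toReal hA).symm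
  set r := (2 * a / ω) ^ (1 / (N : ℝ)) with hr
  have hrpos : 0 < r := by positivity
  have hrN : r ^ N = 2 * a / ω := by
    rw [← Real.rpow_natCast, hr, ← Real.rpow_mul (by positivity), one_div,
      inv_mul_cancel₀ hN0.ne', Real.rpow_one]
  have hrp : r ^ (N + s * p) = (2 / ω) ^ ((N + s * p) / N) * a ^ (s * p / N) * a := by
    rw [hr, ← Real.rpow_mul (by positivity), one_div_mul_eq_div, mul_div_right_comm,
      Real.mul_rpow (by positivity) hapos.le, mul_assoc, ← Real.rpow_add_one hapos.ne']
    congr 2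
    field_simp
    ring
  have hball : ∀ x : EuclideanSpace ℝ (Fin N), ENNReal.ofReal a ≤ volume (Metric.ball x r \ A) := by
    intro x
    have h1 : volume (Metric.ball x r) = ENNReal.ofReal (2 * a) := by
      rw [Measure.addHaar_ball volume x hrpos.le, finrank_euclideanSpace, Fintype.card_fin, hrN,
        ← ENNReal.ofReal_toReal (a := volume (Metric.ball (0 : EuclideanSpace ℝ (Fin N)) 1))
          measure_ball_lt_top.ne, ← hω, ← ENNReal.ofReal_mul (by positivity),
        div_mul_cancel₀ _ hωpos.ne']
    calc ENNReal.ofReal a = volume (Metric.ball x r) - volume A := by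
          rw [h1, hAa, ← ENNReal.ofReal_sub _ hapos.le]
          ring_nf
      _ ≤ _ := le_measure_sdiff
  have hinner : ∀ x : EuclideanSpace ℝ (Fin N),
      ENNReal.ofReal (a / r ^ (N + s * p)) * ENNReal.ofReal (|f x| ^ p) ≤
        ∫⁻ y, ENNReal.ofReal (|f x - f y| ^ p / ‖x - y‖ ^ (N + s * p)) := by
    intro x
    calc ENNReal.ofReal (a / r ^ (N + s * p)) * ENNReal.ofReal (|f x| ^ p)
        = ENNReal.ofReal (|f x| ^ p / r ^ (N + s * p)) * ENNReal.ofReal a := by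
          rw [← ENNReal.ofReal_mul (by positivity), ← ENNReal.ofReal_mul (by positivity)]
          ring_nf
      _ ≤ ENNReal.ofReal (|f x| ^ p / r ^ (N + s * p)) * volume (Metric.ball x r \ A) := by
          gcongr
          exact hball x
      _ = ∫⁻ _ in Metric.ball x r \ A, ENNReal.ofReal (|f x| ^ p / r ^ (N + s * p)) :=
          (setLIntegral_const _ _).symm
      _ ≤ ∫⁻ y in Metric.ball x r \ A,
            ENNReal.ofReal (|f x - f y| ^ p / ‖x - y‖ ^ (N + s * p)) := by
          refine setLIntegral_mono (by fun_prop) fun y hy => ENNReal.ofReal_le_ofReal ?_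
          rw [hfA y hy.2, sub_zero]
          rcases eq_or_ne x y with rfl | hxy
          · simp [hfA x hy.2, Real.zero_rpow hp0.ne']
          · have h1 : 0 < ‖x - y‖ := norm_pos_iff.2 (sub_ne_zero.2 hxy)
            have h2 : ‖x - y‖ ≤ r := by
              rw [← dist_eq_norm, dist_comm]
              exact (Metric.mem_ball.1 hy.1).le
            gcongr
      _ ≤ _ := setLIntegral_le_lintegral _ _
  have hmain : ENNReal.ofReal (a / r ^ (N + s * p)) * ∫⁻ x, ENNReal.ofReal (|f x| ^ p) ≤
      gagliardoEnergy s p f := by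
    rw [gagliardoEnergy, Measure.volume_eq_prod, lintegral_prod _ (by fun_prop),
      ← lintegral_const_mul _ (by fun_prop)]
    exact lintegral_mono hinner
  have hone : ENNReal.ofReal (r ^ (N + s * p) / a) * ENNReal.ofReal (a / r ^ (N + s * p)) = 1 := by
    rw [← ENNReal.ofReal_mul (by positivity), div_mul_div_cancel₀ hapos.ne',
      div_self (by positivity), ENNReal.ofReal_one]
  calc ∫⁻ x, ENNReal.ofReal (|f x| ^ p)
      = ENNReal.ofReal (r ^ (N + s * p) / a) * (ENNReal.ofReal (a / r ^ (N + s * p)) *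
          ∫⁻ x, ENNReal.ofReal (|f x| ^ p)) := by rw [← mul_assoc, hone, one_mul]
    _ ≤ ENNReal.ofReal (r ^ (N + s * p) / a) * gagliardoEnergy s p f := by gcongr
    _ = _ := by
      rw [hrp, mul_div_cancel_right₀ _ hapos.ne', ENNReal.ofReal_mul (by positivity), hAa,
        ENNReal.ofReal_rpow_of_pos hapos]

end FractionalPoincare

/-! ### The fractional Sobolev inequality -/

section SobolevInequality

/-- The part of `t ≥ 0` between the dyadic levels `2 ^ k` and `2 ^ (k + 1)`. -/
noncomputable def dyadicSlice (k : ℤ) (t : ℝ) : ℝ :=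
  min t (2 ^ (k + 1)) - min t (2 ^ k)

theorem dyadicSlice_eq_zero {k : ℤ} {t : ℝ} (h : t ≤ 2 ^ k) : dyadicSlice k t = 0 := by
  have h1 : (2 : ℝ) ^ k ≤ 2 ^ (k + 1) := zpow_le_zpow_right₀ one_le_two (by lia)
  rw [dyadicSlice, min_eq_left h, min_eq_left (h.trans h1), sub_self]

theorem dyadicSlice_eq {k : ℤ} {t : ℝ} (h : 2 ^ (k + 1) ≤ t) : dyadicSlice k t = 2 ^ k := by
  have h1 : (2 : ℝ) ^ k ≤ 2 ^ (k + 1) := zpow_le_zpow_right₀ one_le_two (by lia)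
  rw [dyadicSlice, min_eq_right h, min_eq_right (h1.trans h), zpow_add_one₀ two_ne_zero]
  ring

theorem dyadicSlice_mono (k : ℤ) {a b : ℝ} (h : a ≤ b) : dyadicSlice k a ≤ dyadicSlice k b := by
  have h1 : (2 : ℝ) ^ k ≤ 2 ^ (k + 1) := zpow_le_zpow_right₀ one_le_two (by lia)
  simp only [dyadicSlice]
  rcases min_cases a (2 ^ (k + 1)) with h2 | h2 <;> rcases min_cases a (2 ^ k) with h3 | h3 <;>
  rcases min_cases b (2 ^ (k + 1)) with h4 | h4 <;> rcases min_cases b (2 ^ k) with h5 | h5 <;>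
  linarith

theorem measurable_dyadicSlice (k : ℤ) : Measurable (dyadicSlice k) := by
  unfold dyadicSlice
  fun_prop

/-- The increments of the dyadic slices of a number sum up to at most its own increment, as the sum
over consecutive levels telescopes. -/
theorem sum_abs_dyadicSlice_sub_le (S : Finset ℤ) (a b : ℝ) :
    ∑ k ∈ S, |dyadicSlice k a - dyadicSlice k b| ≤ |a - b| := by
  wlog hab : b ≤ a generalizing a b
  · simpa only [abs_sub_comm] using this b a (le_of_not_ge hab)
  have hnn : ∀ k, 0 ≤ dyadicSlice k a - dyadicSlice k b := fun k =>
    sub_nonneg.2 (dyadicSlice_mono k hab)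
  simp only [abs_of_nonneg (hnn _), abs_of_nonneg (sub_nonneg.2 hab)]
  obtain ⟨m, hm⟩ : ∃ m : ℕ, ∀ k ∈ S, |k| < m := by
    refine ⟨(∑ k ∈ S, k.natAbs) + 1, fun k hk => ?_⟩
    have := Finset.single_le_sum (f := fun k : ℤ => k.natAbs) (fun _ _ => Nat.zero_le _) hk
    rw [Int.abs_eq_natAbs]
    lia
  have hsub : S ⊆ (Finset.range (2 * m)).image fun j : ℕ => (j : ℤ) - m := by
    intro k hk
    have := abs_lt.1 (hm k hk)
    exact Finset.mem_image.2 ⟨(k + m).toNat, Finset.mem_range.2 (by lia), by lia⟩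
  refine (Finset.sum_le_sum_of_subset_of_nonneg hsub fun k _ _ => hnn k).trans ?_
  rw [Finset.sum_image fun i _ j _ hij => by simpa using hij]
  have htel : ∀ t : ℝ, ∑ j ∈ Finset.range (2 * m), dyadicSlice ((j : ℤ) - m) t =
      min t (2 ^ (((2 * m : ℕ) : ℤ) - m)) - min t (2 ^ (((0 : ℕ) : ℤ) - m)) := by
    intro t
    rw [← Finset.sum_range_sub (fun j : ℕ => min t ((2 : ℝ) ^ ((j : ℤ) - m)))]
    refine Finset.sum_congr rfl fun j _ => ?_
    rw [dyadicSlice]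
    congr 3
    push_cast
    ring
  rw [Finset.sum_sub_distrib, htel, htel]
  have h1 := min_le_min_right ((2 : ℝ) ^ (((0 : ℕ) : ℤ) - m)) hab
  have h2 : min a (2 ^ (((2 * m : ℕ) : ℤ) - m)) - min b (2 ^ (((2 * m : ℕ) : ℤ) - m)) ≤ a - b := by
    rcases min_cases a ((2 : ℝ) ^ (((2 * m : ℕ) : ℤ) - m)) with h | h <;>
    rcases min_cases b ((2 : ℝ) ^ (((2 * m : ℕ) : ℤ) - m)) with h' | h' <;> linarith
  linarith

theorem sum_rpow_le_rpow_sum {κ : Type*} (S : Finset κ) {f : κ → ℝ} (hf : ∀ k, 0 ≤ f k) {p : ℝ}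
    (hp : 1 ≤ p) : ∑ k ∈ S, f k ^ p ≤ (∑ k ∈ S, f k) ^ p := by
  classical
  induction S using Finset.induction_on with
  | empty => simp [Real.zero_rpow (by linarith : p ≠ 0)]
  | insert k S hk ih =>
    rw [Finset.sum_insert hk, Finset.sum_insert hk]
    exact (add_le_add_right ih _).trans
      (Real.add_rpow_le_rpow_add (hf k) (Finset.sum_nonneg fun i _ => hf i) hp)

variable {N : ℕ} {s p : ℝ}

/-- The Gagliardo energies of the dyadic slices of `|f|` sum up to at most that of `f`. -/
theorem tsum_gagliardoEnergy_dyadicSlice_le (hp : 1 < p) {f : EuclideanSpace ℝ (Fin N) → ℝ}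
    (hf : Measurable f) :
    ∑' k : ℤ, gagliardoEnergy s p (fun x => dyadicSlice k |f x|) ≤ gagliardoEnergy s p f := by
  have hm := measurable_dyadicSlice
  simp only [gagliardoEnergy]
  rw [← lintegral_tsum fun k => by
    have := hm k
    exact Measurable.aemeasurable (by fun_prop)]
  refine lintegral_mono fun z => ?_
  rw [ENNReal.tsum_eq_iSup_sum]
  refine iSup_le fun S => ?_
  rw [← ENNReal.ofReal_sum_of_nonneg fun k _ => by positivity, ← Finset.sum_div]
  refine ENNReal.ofReal_le_ofReal ?_
  have h1 := (sum_abs_dyadicSlice_sub_le S |f z.1| |f z.2|).trans (abs_abs_sub_abs_le _ _)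
  have h2 := sum_rpow_le_rpow_sum S
    (f := fun k => |dyadicSlice k (|f z.1|) - dyadicSlice k (|f z.2|)|) (fun k => abs_nonneg _) hp.le
  have h3 : (∑ k ∈ S, |dyadicSlice k (|f z.1|) - dyadicSlice k (|f z.2|)|) ^ p ≤
      |f z.1 - f z.2| ^ p :=
    Real.rpow_le_rpow (Finset.sum_nonneg fun k _ => abs_nonneg _) h1 (by linarith)
  have h4 : 0 ≤ ‖z.1 - z.2‖ ^ (N + s * p) := by positivity
  exact div_le_div_of_nonneg_right (h2.trans h3) h4

/-- The fractional Sobolev inequality with an unspecified constant, by Maz'ya's truncation method: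
the Poincaré inequality is applied to each dyadic slice, and the results are summed. -/
theorem exists_lintegral_sobolev (hN : 1 ≤ N) (hs : s ∈ Ioo (0 : ℝ) 1) (hp : 1 < p)
    (hsp : s * p < N) :
    ∃ K : ℝ, 0 < K ∧ ∀ f : EuclideanSpace ℝ (Fin N) → ℝ, Measurable f →
      ∫⁻ x, ENNReal.ofReal (|f x| ^ (N * p / (N - s * p))) ≠ ∞ →
      ∫⁻ x, ENNReal.ofReal (|f x| ^ (N * p / (N - s * p))) ≤ ENNReal.ofReal K *
        (∫⁻ x, ENNReal.ofReal (|f x| ^ (N * p / (N - s * p)))) ^ (s * p / N) *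
          gagliardoEnergy s p f := by
  have hp0 : 0 < p := by linarith
  have hsp0 : 0 < s * p := mul_pos hs.1 hp0
  have hN0 : (0 : ℝ) < N := by exact_mod_cast hN
  have hNsp : 0 < N - s * p := by linarith
  obtain ⟨C, hC, hpoin⟩ := exists_lintegral_rpow_le_gagliardoEnergy hN hs hp
  set P : ℝ := N * p / (N - s * p) with hP
  have hP0 : 0 < P := by positivity
  set β : ℝ := s * p / N with hβ
  have hβ0 : 0 < β := by positivity
  have hPβ : p + P * β = P := by
    have h : P * (N - s * p) = N * p := div_mul_cancel₀ _ hNsp.ne'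
    rw [hβ, ← mul_div_assoc]
    field_simp
    linarith
  refine ⟨2 ^ P * 2 ^ P * C, by positivity, fun f hf hfin => ?_⟩
  set I := ∫⁻ x, ENNReal.ofReal (|f x| ^ P) with hI
  set A : ℤ → Set (EuclideanSpace ℝ (Fin N)) := fun k => {x | (2 : ℝ) ^ k < |f x|} with hA
  have hAm : ∀ k, MeasurableSet (A k) := fun k => measurableSet_lt measurable_const hf.abs
  have h2pos : ∀ k : ℤ, (0 : ℝ) < 2 ^ k := fun k => zpow_pos two_pos k
  set b : ℤ → ℝ≥0∞ := fun k => ENNReal.ofReal (((2 : ℝ) ^ k) ^ P) * volume (A k) with hb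
  -- Chebyshev's inequality
  have hbI : ∀ k, b k ≤ I := by
    intro k
    rw [hb, hI]
    dsimp only
    rw [← setLIntegral_const]
    refine (setLIntegral_mono (by fun_prop) fun x hx => ENNReal.ofReal_le_ofReal ?_).trans
      (setLIntegral_le_lintegral _ _)
    exact Real.rpow_le_rpow (h2pos k).le (le_of_lt hx) hP0.le
  have hAfin : ∀ k, volume (A k) ≠ ∞ := by
    intro k hk
    have := hbI k
    rw [hb] at this
    dsimp only at this
    rw [hk, ENNReal.mul_top (by simpa using Real.rpow_pos_of_pos (h2pos k) P)] at this
    exact hfin (top_le_iff.1 this)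
  have hstep : ∀ k, b (k + 1) ≤ ENNReal.ofReal (2 ^ P * C) * I ^ β *
      gagliardoEnergy s p (fun x => dyadicSlice k |f x|) := by
    intro k
    have h1 := hpoin (fun x => dyadicSlice k |f x|) (A k)
      ((measurable_dyadicSlice k).comp hf.abs) (hAfin k)
      (fun x hx => dyadicSlice_eq_zero (not_lt.1 hx))
    have h2 : ENNReal.ofReal (((2 : ℝ) ^ k) ^ p) * volume (A (k + 1)) ≤
        ∫⁻ x, ENNReal.ofReal (|dyadicSlice k (|f x|)| ^ p) := by
      rw [← setLIntegral_const]
      have hm := measurable_dyadicSlice k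
      refine (setLIntegral_mono (by fun_prop) fun x hx => ENNReal.ofReal_le_ofReal ?_).trans
        (setLIntegral_le_lintegral _ _)
      rw [dyadicSlice_eq (le_of_lt hx), abs_of_pos (h2pos k)]
    have h3 : ((2 : ℝ) ^ (k + 1)) ^ P =
        2 ^ P * ((((2 : ℝ) ^ k) ^ P) ^ β * ((2 : ℝ) ^ k) ^ p) := by
      rw [← Real.rpow_mul (h2pos k).le, ← Real.rpow_add (h2pos k), add_comm (P * β), hPβ,
        ← Real.mul_rpow two_pos.le (h2pos k).le, zpow_add_one₀ two_ne_zero, mul_comm]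
    calc b (k + 1) = ENNReal.ofReal (2 ^ P) * ENNReal.ofReal (((2 : ℝ) ^ k) ^ P) ^ β *
          (ENNReal.ofReal (((2 : ℝ) ^ k) ^ p) * volume (A (k + 1))) := by
          rw [hb]
          dsimp only
          rw [h3, ENNReal.ofReal_mul (by positivity), ENNReal.ofReal_mul (by positivity),
            ENNReal.ofReal_rpow_of_nonneg (by positivity) hβ0.le]
          ring
      _ ≤ ENNReal.ofReal (2 ^ P) * ENNReal.ofReal (((2 : ℝ) ^ k) ^ P) ^ β *
          (ENNReal.ofReal C * volume (A k) ^ β *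
            gagliardoEnergy s p (fun x => dyadicSlice k |f x|)) := by
          exact mul_le_mul_right (h2.trans h1) _
      _ = ENNReal.ofReal (2 ^ P * C) * b k ^ β *
            gagliardoEnergy s p (fun x => dyadicSlice k |f x|) := by
          rw [hb]
          dsimp only
          rw [ENNReal.mul_rpow_of_nonneg _ _ hβ0.le, ENNReal.ofReal_mul (by positivity)]
          ring
      _ ≤ _ := by
          gcongr
          exact hbI k
  have hdyadic : I ≤ ENNReal.ofReal (2 ^ P) * ∑' k, b k := by
    have h1 : ∀ x, ENNReal.ofReal (|f x| ^ P) ≤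
        ∑' k : ℤ, (A k).indicator (fun _ => ENNReal.ofReal (((2 : ℝ) ^ (k + 1)) ^ P)) x := by
      intro x
      rcases (abs_nonneg (f x)).eq_or_lt with h | h
      · rw [← h, Real.zero_rpow hP0.ne', ENNReal.ofReal_zero]
        exact zero_le
      · obtain ⟨k, hk1, hk2⟩ := exists_mem_Ioc_zpow h one_lt_two
        refine le_trans ?_ (ENNReal.le_tsum k)
        rw [indicator_of_mem (show x ∈ A k from hk1)]
        gcongr
    calc I ≤ ∫⁻ x, ∑' k : ℤ,
          (A k).indicator (fun _ => ENNReal.ofReal (((2 : ℝ) ^ (k + 1)) ^ P)) x :=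
          lintegral_mono h1
      _ = ∑' k : ℤ, ENNReal.ofReal (((2 : ℝ) ^ (k + 1)) ^ P) * volume (A k) := by
          rw [lintegral_tsum fun k => (measurable_const.indicator (hAm k)).aemeasurable]
          exact tsum_congr fun k => lintegral_indicator_const (hAm k) _
      _ = ENNReal.ofReal (2 ^ P) * ∑' k, b k := by
          rw [← ENNReal.tsum_mul_left]
          refine tsum_congr fun k => ?_
          rw [hb]
          dsimp only
          rw [zpow_add_one₀ two_ne_zero, mul_comm ((2 : ℝ) ^ k) 2,
            Real.mul_rpow two_pos.le (h2pos k).le, ENNReal.ofReal_mul (by positivity), mul_assoc]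
  calc I ≤ ENNReal.ofReal (2 ^ P) * ∑' k, b k := hdyadic
    _ = ENNReal.ofReal (2 ^ P) * ∑' k, b (k + 1) := by
        rw [(Equiv.addRight (1 : ℤ)).tsum_eq b |>.symm]
        rfl
    _ ≤ ENNReal.ofReal (2 ^ P) * ∑' k, ENNReal.ofReal (2 ^ P * C) * I ^ β *
          gagliardoEnergy s p (fun x => dyadicSlice k |f x|) := by
        gcongr with k
        exact hstep k
    _ = ENNReal.ofReal (2 ^ P * 2 ^ P * C) * I ^ β *
          ∑' k, gagliardoEnergy s p (fun x => dyadicSlice k |f x|) := by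
        rw [ENNReal.tsum_mul_left, mul_assoc (2 ^ P) (2 ^ P) C,
          ENNReal.ofReal_mul (p := 2 ^ P) (q := 2 ^ P * C) (by positivity)]
        ring
    _ ≤ _ := by
        gcongr
        exact tsum_gagliardoEnergy_dyadicSlice_le hp hf

end SobolevInequality

/-! ### The best Sobolev constant -/

section SobolevConstant

variable {N : ℕ} {s p : ℝ}

theorem gagliardoEnergy_smul (hp : 1 < p) (c : ℝ) (u : EuclideanSpace ℝ (Fin N) → ℝ) :
    gagliardoEnergy s p (c • u) = ‖c‖ₑ ^ p * gagliardoEnergy s p u := by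
  rw [gagliardoEnergy_eq_eLpNorm hp, gagliardoEnergy_eq_eLpNorm hp, gagliardoQuotient_smul,
    eLpNorm_const_smul, ENNReal.mul_rpow_of_nonneg _ _ (by linarith)]

theorem TestFunction.eLpNorm_lt_top {Ω : Opens (EuclideanSpace ℝ (Fin N))} (φ : 𝓓(Ω, ℝ))
    (r : ℝ≥0∞) : eLpNorm φ r volume < ∞ :=
  (φ.continuous.memLp_of_hasCompactSupport φ.hasCompactSupport).2

/-- The normalization of a test function to unit norm in `L^r`. -/
theorem TestFunction.eLpNorm_normalize {Ω : Opens (EuclideanSpace ℝ (Fin N))} (φ : 𝓓(Ω, ℝ))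
    {r : ℝ≥0∞} (h : eLpNorm φ r volume ≠ 0) :
    eLpNorm ((eLpNorm φ r volume).toReal⁻¹ • φ : 𝓓(Ω, ℝ)) r volume = 1 := by
  have hpos := ENNReal.toReal_pos h (φ.eLpNorm_lt_top r).ne
  rw [FunLike.coe_smul, eLpNorm_const_smul, Real.enorm_eq_ofReal (by positivity),
    ENNReal.ofReal_inv_of_pos hpos, ENNReal.ofReal_toReal (φ.eLpNorm_lt_top r).ne,
    ENNReal.inv_mul_cancel h (φ.eLpNorm_lt_top r).ne]

theorem exists_testFunction_ne_zero (N : ℕ) :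
    ∃ φ : 𝓓((⊤ : Opens (EuclideanSpace ℝ (Fin N))), ℝ), φ 0 ≠ 0 := by
  let f : ContDiffBump (0 : EuclideanSpace ℝ (Fin N)) := ⟨1, 2, one_pos, one_lt_two⟩
  refine ⟨⟨f, f.contDiff, f.hasCompactSupport, fun _ _ => trivial⟩, ?_⟩
  have h : f 0 = 1 := f.one_of_mem_closedBall (Metric.mem_closedBall_self f.rIn_pos.le)
  change f 0 ≠ 0
  rw [h]
  exact one_ne_zero

/-- The best constant of the fractional Sobolev inequality is not zero: this is the Sobolev
inequality itself. -/
theorem sobolevConst_pos (hN : 1 ≤ N) (hs : s ∈ Ioo (0 : ℝ) 1) (hp : 1 < p) (hsp : s * p < N) :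
    0 < sobolevConst N s p := by
  have hp0 : 0 < p := by linarith
  have hN0 : (0 : ℝ) < N := by exact_mod_cast hN
  have hP0 : 0 < N * p / (N - s * p) := div_pos (by positivity) (by linarith)
  obtain ⟨K, hK, hsob⟩ := exists_lintegral_sobolev hN hs hp hsp
  refine (inv_pos.2 hK).trans_le (le_csInf ?_ ?_)
  · obtain ⟨φ, hφ⟩ := exists_testFunction_ne_zero N
    refine ⟨_, _, φ.eLpNorm_normalize fun h => hφ ?_, rfl⟩
    rw [eLpNorm_eq_zero_iff φ.continuous.aestronglyMeasurable (by simpa using hP0)] at h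
    exact congrFun ((φ.continuous.ae_eq_iff_eq _ continuous_const).1 h) 0
  · rintro _ ⟨φ, hφ, rfl⟩
    have hI : ∫⁻ x, ENNReal.ofReal (|φ x| ^ (N * p / (N - s * p))) = 1 := by
      rw [eLpNorm_eq_lintegral_rpow_enorm_toReal (by simpa using hP0) ENNReal.ofReal_ne_top,
        ENNReal.toReal_ofReal hP0.le] at hφ
      have h1 := congrArg (fun t : ℝ≥0∞ => t ^ (N * p / (N - s * p))) hφ
      rw [← ENNReal.rpow_mul, one_div, inv_mul_cancel₀ hP0.ne', ENNReal.rpow_one,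
        ENNReal.one_rpow] at h1
      rw [← h1]
      refine lintegral_congr fun x => ?_
      rw [← ofReal_norm, ENNReal.ofReal_rpow_of_nonneg (norm_nonneg _) hP0.le, Real.norm_eq_abs]
    have h2 := hsob φ φ.continuous.measurable (by rw [hI]; exact ENNReal.one_ne_top)
    rw [hI, ENNReal.one_rpow, mul_one] at h2
    have h3 := ENNReal.toReal_mono (ENNReal.mul_ne_top ENNReal.ofReal_ne_top
      (gagliardoEnergy_testFunction_lt_top hs hp φ).ne) h2
    rw [ENNReal.toReal_one, ENNReal.toReal_mul, ENNReal.toReal_ofReal hK.le] at h3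
    rwa [inv_le_iff_one_le_mul₀' hK]

/-- The Sobolev inequality for test functions, with the best constant. -/
theorem sobolevConst_mul_rpow_le (hp : 1 < p)
    (φ : 𝓓((⊤ : Opens (EuclideanSpace ℝ (Fin N))), ℝ)) :
    sobolevConst N s p *
        (eLpNorm φ (ENNReal.ofReal (N * p / (N - s * p))) volume).toReal ^ p ≤
      (gagliardoEnergy s p φ).toReal := by
  have hp0 : 0 < p := by linarith
  set r := ENNReal.ofReal (N * p / (N - s * p)) with hr
  rcases eq_or_ne (eLpNorm φ r volume) 0 with h | h
  · rw [h, ENNReal.toReal_zero, Real.zero_rpow hp0.ne', mul_zero]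
    exact ENNReal.toReal_nonneg
  have hpos := ENNReal.toReal_pos h (φ.eLpNorm_lt_top r).ne
  set n := (eLpNorm φ r volume).toReal with hn
  have hbdd : BddBelow {e : ℝ | ∃ φ : 𝓓((⊤ : Opens (EuclideanSpace ℝ (Fin N))), ℝ),
      eLpNorm φ r volume = 1 ∧ e = (gagliardoEnergy s p φ).toReal} := by
    refine ⟨0, ?_⟩
    rintro _ ⟨ψ, -, rfl⟩
    exact ENNReal.toReal_nonneg
  have h1 : sobolevConst N s p ≤ (gagliardoEnergy s p (n⁻¹ • φ :
      𝓓((⊤ : Opens (EuclideanSpace ℝ (Fin N))), ℝ))).toReal :=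
    csInf_le hbdd ⟨_, φ.eLpNorm_normalize h, rfl⟩
  rw [FunLike.coe_smul, gagliardoEnergy_smul hp, ENNReal.toReal_mul, ← ENNReal.toReal_rpow,
    toReal_enorm, Real.norm_of_nonneg (by positivity), Real.inv_rpow hpos.le] at h1
  rwa [← le_div_iff₀ (by positivity), div_eq_inv_mul]

variable {hs : s ∈ Ioo (0 : ℝ) 1} {hp : 1 < p} {Ω : Opens (EuclideanSpace ℝ (Fin N))}
  {ι : HomogeneousSobolev hs hp Ω →L[ℝ]
      Lp ℝ 1 (volume.restrict (Ω : Set (EuclideanSpace ℝ (Fin N))))}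

/-- The Sobolev inequality on `D_0^{s,p}(Ω)`, by density and Fatou's lemma. -/
theorem eLpNorm_zeroExtension_le (hN : 1 ≤ N) (hsp : s * p < N) (hι : IsL1Embedding ι)
    (v : HomogeneousSobolev hs hp Ω) :
    eLpNorm (zeroExtension ι v) (ENNReal.ofReal (N * p / (N - s * p))) volume ≤
      ENNReal.ofReal (sobolevConst N s p ^ (-(1 / p)) * ‖v‖) := by
  have hp0 : 0 < p := by linarith
  have hS := sobolevConst_pos hN hs hp hsp
  have htest : ∀ φ : GagliardoTestSpace hs hp Ω,
      eLpNorm φ.toTestFunction (ENNReal.ofReal (N * p / (N - s * p))) volume ≤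
        ENNReal.ofReal (sobolevConst N s p ^ (-(1 / p)) * ‖φ‖) := by
    intro φ
    have h1 := sobolevConst_mul_rpow_le (s := s) hp
      (⟨φ.toTestFunction, φ.toTestFunction.contDiff, φ.toTestFunction.hasCompactSupport,
        fun _ _ => trivial⟩ : 𝓓((⊤ : Opens (EuclideanSpace ℝ (Fin N))), ℝ))
    change sobolevConst N s p * (eLpNorm φ.toTestFunction _ volume).toReal ^ p ≤
      (gagliardoEnergy s p φ.toTestFunction).toReal at h1
    have hfin := φ.toTestFunction.eLpNorm_lt_top (ENNReal.ofReal (N * p / (N - s * p)))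
    rw [← ENNReal.ofReal_toReal hfin.ne]
    refine ENNReal.ofReal_le_ofReal ?_
    rw [GagliardoTestSpace.norm_eq, Real.rpow_neg hS.le, ← div_eq_inv_mul,
      ← Real.div_rpow ENNReal.toReal_nonneg hS.le]
    rw [← le_div_iff₀' hS] at h1
    calc (eLpNorm φ.toTestFunction _ volume).toReal
        = ((eLpNorm φ.toTestFunction (ENNReal.ofReal (N * p / (N - s * p))) volume).toReal ^ p)
            ^ (1 / p) := by
          rw [one_div, Real.rpow_rpow_inv ENNReal.toReal_nonneg hp0.ne']
      _ ≤ _ := Real.rpow_le_rpow (by positivity) h1 (by positivity)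
  obtain ⟨φ, h1, h2⟩ := exists_seq_testFunction hι v
  refine (Lp.eLpNorm_lim_le_liminf_eLpNorm
    (fun n => (φ n).toTestFunction.continuous.aestronglyMeasurable) _ h2).trans ?_
  have h3 : Tendsto (fun n => ENNReal.ofReal (sobolevConst N s p ^ (-(1 / p)) * ‖φ n‖)) atTop
      (𝓝 (ENNReal.ofReal (sobolevConst N s p ^ (-(1 / p)) * ‖v‖))) := by
    refine ENNReal.tendsto_ofReal (Tendsto.const_mul _ ?_)
    simpa only [UniformSpace.Completion.norm_coe] using h1.norm
  rw [← h3.liminf_eq]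
  exact liminf_le_liminf (Eventually.of_forall fun n => htest (φ n))

end SobolevConstant

/-! ### A level set argument -/

section LevelSets

/-- An integrable function `h` whose truncations `f k = ∫ (h - k)_+` satisfy
`f k ≤ K |{h > k}| ^ γ` with `γ > 1` is bounded above. Since `f' = -|{h > k}|`, the function
`f ^ (1 - 1 / γ)` decreases at least linearly as long as it is positive. -/
theorem ae_le_of_integral_truncation_le {α : Type*} [MeasurableSpace α] {μ : Measure α}
    {h : α → ℝ} (hm : Measurable h) (hi : Integrable h μ) {K γ : ℝ} (hK : 0 < K) (hγ : 1 < γ)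
    (H : ∀ k > 0, ∫ x, max (h x - k) 0 ∂μ ≤ K * μ.real {x | k < h x} ^ γ) :
    ∀ᵐ x ∂μ, h x ≤ γ / (γ - 1) * K ^ (1 / γ) * (∫ x, max (h x) 0 ∂μ) ^ (1 - 1 / γ) := by
  have hγ0 : 0 < γ := by linarith
  set a := 1 / γ with ha
  have ha0 : 0 < a := by positivity
  have ha1 : 0 < 1 - a := by
    rw [ha, sub_pos, div_lt_one hγ0]
    exact hγ
  set f : ℝ → ℝ := fun k => ∫ x, max (h x - k) 0 ∂μ with hf
  have hbound : ∀ k, 0 ≤ k → ∀ x, |max (h x - k) 0| ≤ |h x| := by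
    intro k hk x
    rw [abs_of_nonneg (le_max_right _ _)]
    exact max_le (by linarith [le_abs_self (h x)]) (abs_nonneg _)
  have hint : ∀ k, 0 ≤ k → Integrable (fun x => max (h x - k) 0) μ := fun k hk =>
    hi.mono (by fun_prop) (ae_of_all _ (hbound k hk))
  have hfnn : ∀ k, 0 ≤ f k := fun k => integral_nonneg fun x => le_max_right _ _
  have hf0 : f 0 = ∫ x, max (h x) 0 ∂μ := by simp [hf]
  have hdecr : ∀ x z, 0 ≤ x → x < z → (z - x) * μ.real {y | z < h y} ≤ f x - f z := by
    intro x z hx hxz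
    have hz : 0 < z := hx.trans_lt hxz
    have hset : MeasurableSet {y | z < h y} := measurableSet_lt measurable_const hm
    rw [hf]
    dsimp only
    rw [← integral_sub (hint x hx) (hint z hz.le), mul_comm, ← smul_eq_mul,
      ← integral_indicator_const _ hset]
    refine integral_mono ((integrable_indicator_iff hset).2 (integrableOn_const
      (hi.measure_gt_lt_top hz).ne)) ((hint x hx).sub (hint z hz.le)) fun y => ?_
    by_cases hy : z < h y
    · rw [indicator_of_mem (show y ∈ {y | z < h y} from hy), max_eq_left (by linarith),
        max_eq_left (by linarith)]
      linarith
    · rw [indicator_of_notMem (show y ∉ {y | z < h y} from hy), sub_nonneg]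
      exact max_le_max (by linarith) le_rfl
  have hanti : ∀ x z, 0 ≤ x → x < z → f z ≤ f x := fun x z hx hxz => by
    have := hdecr x z hx hxz
    have h1 : 0 ≤ (z - x) * μ.real {y | z < h y} :=
      mul_nonneg (by linarith) measureReal_nonneg
    linarith
  set T := γ / (γ - 1) * K ^ a * (∫ x, max (h x) 0 ∂μ) ^ (1 - a) with hT
  have hT0 : 0 ≤ T := by
    have h1 : 0 < γ - 1 := by linarith
    have h2 : 0 ≤ ∫ x, max (h x) 0 ∂μ := hf0 ▸ hfnn 0
    positivity
  suffices hfT : f T = 0 by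
    have h1 := (integral_eq_zero_iff_of_nonneg (fun x => le_max_right _ _) (hint T hT0)).1 hfT
    filter_upwards [h1] with x hx
    have : h x - T ≤ 0 := (le_max_left _ _).trans hx.le
    linarith
  by_contra hne
  have hTpos : 0 < f T := lt_of_le_of_ne (hfnn T) (Ne.symm hne)
  have hpos : ∀ x ∈ Icc 0 T, 0 < f x := by
    intro x hx
    rcases hx.2.eq_or_lt with h | h
    · rwa [h]
    · exact hTpos.trans_le (hanti x T hx.1 h)
  have hcont : ContinuousOn f (Icc 0 T) := by
    refine continuousOn_of_dominated (bound := fun x => |h x|) (fun k hk => (hint k hk.1).1)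
      (fun k hk => ae_of_all _ fun x => hbound k hk.1 x) hi.abs (ae_of_all _ fun x => ?_)
    fun_prop
  have hgcont : ContinuousOn (fun x => f x ^ (1 - a)) (Icc 0 T) :=
    hcont.rpow_const fun x hx => Or.inl (hpos x hx).ne'
  set c := (1 - a) * (K ^ a)⁻¹ with hc
  have hfence := image_le_of_liminf_slope_right_le_deriv_boundary (f := fun x => f x ^ (1 - a))
    (B := fun x => f 0 ^ (1 - a) - c * x) (B' := fun _ => -c) hgcont (by simp) (by fun_prop)
    (fun x _ => by
      simpa using (((hasDerivAt_id x).const_mul c).const_sub (f 0 ^ (1 - a))).hasDerivWithinAt)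
    (fun x hx r hr => by
      have hfx := hpos x (Ico_subset_Icc_self hx)
      have hnear : ∀ᶠ z in 𝓝[>] x, z ∈ Ioc x T := Ioc_mem_nhdsGT hx.2
      have hslope : ∀ᶠ z in 𝓝[>] x, slope (fun x => f x ^ (1 - a)) x z ≤
          -((1 - a) * (f x ^ a)⁻¹ * (f z / K) ^ a) := by
        filter_upwards [hnear] with z hz
        have hzx : 0 < z - x := by linarith [hz.1]
        have hfz := hpos z ⟨hx.1.trans hz.1.le, hz.2⟩
        -- concavity of `t ↦ t ^ (1 - a)`
        have h1 := rpow_one_add_le_one_add_mul_self (s := (f z - f x) / f x)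
          (by rw [le_div_iff₀ hfx]; linarith) ha1.le (by linarith : 1 - a ≤ 1)
        rw [show 1 + (f z - f x) / f x = f z / f x by field_simp; ring,
          Real.div_rpow hfz.le hfx.le, div_le_iff₀ (by positivity)] at h1
        have h2 : f x ^ (1 - a) = f x * (f x ^ a)⁻¹ := by
          rw [Real.rpow_sub hfx, Real.rpow_one, div_eq_mul_inv]
        have h3 : (1 + (1 - a) * ((f z - f x) / f x)) * f x ^ (1 - a) =
            f x ^ (1 - a) + (1 - a) * (f x ^ a)⁻¹ * (f z - f x) := by
          rw [add_mul, one_mul, h2]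
          field_simp
        have h4 : (f z / K) ^ a ≤ μ.real {y | z < h y} := by
          have h5 := H z (hx.1.trans_lt hz.1)
          rw [← div_le_iff₀' hK] at h5
          calc (f z / K) ^ a ≤ (μ.real {y | z < h y} ^ γ) ^ a :=
                Real.rpow_le_rpow (by positivity) h5 ha0.le
            _ = μ.real {y | z < h y} := by
                rw [ha, one_div, Real.rpow_rpow_inv measureReal_nonneg hγ0.ne']
        have h5 := hdecr x z hx.1 hz.1
        have h6 := mul_le_mul_of_nonneg_left h4 hzx.le
        have h7 : 0 ≤ (1 - a) * (f x ^ a)⁻¹ := by positivity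
        have h8 := mul_le_mul_of_nonneg_left (h6.trans h5) h7
        rw [slope_def_field, div_le_iff₀ hzx]
        linarith
      have hlim : Tendsto (fun z => -((1 - a) * (f x ^ a)⁻¹ * (f z / K) ^ a)) (𝓝[>] x)
          (𝓝 (-((1 - a) * (f x ^ a)⁻¹ * (f x / K) ^ a))) := by
        have h1 : Tendsto f (𝓝[>] x) (𝓝 (f x)) :=
          (hcont x (Ico_subset_Icc_self hx)).mono_left
            (nhdsWithin_le_of_mem (Icc_mem_nhdsGT_of_mem hx))
        exact (((h1.div_const K).rpow_const (Or.inr ha0.le)).const_mul _).neg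
      have heq : -((1 - a) * (f x ^ a)⁻¹ * (f x / K) ^ a) = -c := by
        rw [Real.div_rpow hfx.le hK.le, hc]
        have : f x ^ a ≠ 0 := by positivity
        field_simp
      rw [heq] at hlim
      refine Eventually.frequently ?_
      filter_upwards [hslope, hlim.eventually_lt_const hr] with z h1 h2
      exact h1.trans_lt h2)
  have hend : f T ^ (1 - a) ≤ f 0 ^ (1 - a) - c * T := hfence ⟨hT0, le_rfl⟩
  have hcT : c * T = f 0 ^ (1 - a) := by
    have hγ1 : γ - 1 ≠ 0 := by linarith
    rw [hT, hc, hf0, show 1 - a = (γ - 1) / γ by rw [ha]; field_simp]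
    field_simp
  rw [hcT, sub_self] at hend
  exact absurd hend (not_le.2 (Real.rpow_pos_of_pos hTpos _))

end LevelSets

/-! ### Boundedness of the torsion function -/

section Boundedness

/-- Hölder's inequality for a function vanishing off a set of finite measure. -/
theorem integral_le_eLpNorm_mul_rpow {α : Type*} [MeasurableSpace α] {μ : Measure α} {g : α → ℝ}
    {A : Set α} (hg : Integrable g μ) (hA : MeasurableSet A) (hAfin : μ A ≠ ∞)
    (hgA : ∀ᵐ x ∂μ, x ∉ A → g x = 0) {r M : ℝ} (hr : 1 ≤ r) (hM : 0 ≤ M)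
    (hgM : eLpNorm g (ENNReal.ofReal r) μ ≤ ENNReal.ofReal M) :
    ∫ x, g x ∂μ ≤ M * μ.real A ^ (1 - 1 / r) := by
  have hr0 : 0 < r := by linarith
  have hexp : 0 ≤ 1 - 1 / r := sub_nonneg.2 ((div_le_one hr0).2 hr)
  have h1 : ENNReal.ofReal (∫ x, g x ∂μ) ≤ ENNReal.ofReal (M * μ.real A ^ (1 - 1 / r)) := by
    calc ENNReal.ofReal (∫ x, g x ∂μ) ≤ eLpNorm g 1 μ := by
          rw [eLpNorm_one_eq_lintegral_enorm]
          exact (Real.ofReal_le_enorm _).trans (enorm_integral_le_lintegral_enorm _)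
      _ = eLpNorm (A.indicator g) 1 μ := by
          refine eLpNorm_congr_ae ?_
          filter_upwards [hgA] with x hx
          by_cases hxA : x ∈ A
          · rw [indicator_of_mem hxA]
          · rw [indicator_of_notMem hxA, hx hxA]
      _ = eLpNorm g 1 (μ.restrict A) := eLpNorm_indicator_eq_eLpNorm_restrict hA
      _ ≤ eLpNorm g (ENNReal.ofReal r) (μ.restrict A) * μ A ^ (1 - 1 / r) := by
          have := eLpNorm_le_eLpNorm_mul_rpow_measure_univ (μ := μ.restrict A) (f := g) (p := 1)
            (q := ENNReal.ofReal r) (by simpa using hr) hg.1.restrict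
          rwa [ENNReal.toReal_one, ENNReal.toReal_ofReal hr0.le, div_one,
            Measure.restrict_apply_univ] at this
      _ ≤ ENNReal.ofReal M * ENNReal.ofReal (μ.real A) ^ (1 - 1 / r) := by
          rw [ofReal_measureReal hAfin]
          gcongr
          exact (eLpNorm_mono_measure _ Measure.restrict_le_self).trans hgM
      _ = _ := by
          rw [ENNReal.ofReal_rpow_of_nonneg measureReal_nonneg hexp, ENNReal.ofReal_mul hM]
  exact (ENNReal.ofReal_le_ofReal_iff
    (mul_nonneg hM (Real.rpow_nonneg measureReal_nonneg _))).1 h1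

variable {N : ℕ} {s p : ℝ} {hs : s ∈ Ioo (0 : ℝ) 1} {hp : 1 < p}
  {Ω : Opens (EuclideanSpace ℝ (Fin N))}
  {ι : HomogeneousSobolev hs hp Ω →L[ℝ]
      Lp ℝ 1 (volume.restrict (Ω : Set (EuclideanSpace ℝ (Fin N))))}

/-- The `L^∞` bound for the torsion function that follows from an inequality between the `L^1` norm
of a truncation, its Gagliardo norm, and the measure of the level set. The power of the measure is
dictated by scaling. -/
theorem IsTorsionFunction.ae_le (hN : 1 ≤ N) (hι : IsL1Embedding ι)
    {w : HomogeneousSobolev hs hp Ω} (hw : IsTorsionFunction ι w) {κ : ℝ} (hκ : 0 < κ)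
    (H : ∀ k > 0, ∀ v : HomogeneousSobolev hs hp Ω,
      (zeroExtension ι v =ᵐ[volume] fun x => max (zeroExtension ι w x - k) 0) →
      ∫ x, zeroExtension ι v x ≤
        κ * ‖v‖ * volume.real {x | k < zeroExtension ι w x} ^ (1 - 1 / p + s / N)) :
    ∀ᵐ x, zeroExtension ι w x ≤
      (N + s * p.conjExponent) / (s * p.conjExponent) * κ ^ (1 / (1 - 1 / p + s / N)) *
        (∫ x, zeroExtension ι w x) ^ (s * p.conjExponent / (N + s * p.conjExponent)) := by
  have hp0 : 0 < p := by linarith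
  have hs0 := hs.1
  have hN0 : (0 : ℝ) < N := by exact_mod_cast hN
  have hpq : p.HolderConjugate p.conjExponent := Real.HolderConjugate.conjExponent hp
  set q := p.conjExponent with hq
  have hq0 : 0 < q := hpq.symm.pos
  have hqp : 1 - 1 / p = 1 / q := by
    have := hpq.inv_add_inv_eq_one
    rw [one_div, one_div]
    linarith
  rw [hqp] at H ⊢
  set γ : ℝ := (N + s * q) / N with hγ
  have hγ1 : 1 < γ := by
    rw [hγ, lt_div_iff₀ hN0, one_mul]
    linarith [mul_pos hs0 hq0]
  have hθ : (1 / q + s / N) * q = γ := by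
    rw [hγ]
    field_simp
  have hmain := ae_le_of_integral_truncation_le (measurable_zeroExtension w)
    (integrable_zeroExtension (ι := ι) w) (Real.rpow_pos_of_pos hκ q) hγ1 fun k hk => by
      obtain ⟨v, hv⟩ := exists_zeroExtension_eq_truncation hι w (le_of_lt hk)
      have h1 := hw.norm_truncation_rpow_le hι hv
      have h2 := H k hk v hv
      rw [← integral_congr_ae hv]
      set f := ∫ x, zeroExtension ι v x
      set m := volume.real {x | k < zeroExtension ι w x}
      have hm0 : 0 ≤ m := measureReal_nonneg
      have hf0 : 0 ≤ f := (by positivity : (0 : ℝ) ≤ ‖v‖ ^ p).trans h1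
      have h3 : ‖v‖ ≤ f ^ (1 / p) := by
        calc ‖v‖ = (‖v‖ ^ p) ^ (1 / p) := by
              rw [one_div, Real.rpow_rpow_inv (norm_nonneg _) hp0.ne']
          _ ≤ f ^ (1 / p) := by gcongr
      rcases hf0.eq_or_lt with hf | hf
      · rw [← hf]
        positivity
      have h4 : f ^ (1 / q) ≤ κ * m ^ (1 / q + s / N) := by
        have h5 : f = f ^ (1 / p) * f ^ (1 / q) := by
          rw [← Real.rpow_add hf, ← hqp, add_sub_cancel, Real.rpow_one]
        have h6 : f ^ (1 / p) * f ^ (1 / q) ≤ f ^ (1 / p) * (κ * m ^ (1 / q + s / N)) := by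
          rw [← h5]
          calc f ≤ κ * ‖v‖ * m ^ (1 / q + s / N) := h2
            _ ≤ κ * f ^ (1 / p) * m ^ (1 / q + s / N) := by gcongr
            _ = _ := by ring
        exact le_of_mul_le_mul_left h6 (by positivity)
      calc f = (f ^ (1 / q)) ^ q := by rw [one_div, Real.rpow_inv_rpow hf0 hq0.ne']
        _ ≤ (κ * m ^ (1 / q + s / N)) ^ q := by gcongr
        _ = κ ^ q * m ^ γ := by
          rw [Real.mul_rpow hκ.le (by positivity), ← Real.rpow_mul hm0, hθ]
  have hpos : ∫ x, max (zeroExtension ι w x) 0 = ∫ x, zeroExtension ι w x := by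
    refine integral_congr_ae ?_
    filter_upwards [hw.zeroExtension_nonneg hι] with x hx using max_eq_left hx
  have hsq := mul_pos hs0 hq0
  have e1 : γ / (γ - 1) = (N + s * q) / (s * q) := by
    rw [hγ]
    field_simp
    ring
  have e2 : 1 - 1 / γ = s * q / (N + s * q) := by
    rw [hγ]
    field_simp
    ring
  have e3 : (κ ^ q) ^ (1 / γ) = κ ^ (1 / (1 / q + s / N)) := by
    rw [← Real.rpow_mul hκ.le, ← hθ]
    congr 1
    field_simp
  rwa [hpos, e1, e2, e3] at hmain

theorem gagliardoEnergy_congr_ae (hp : 1 < p) {u v : EuclideanSpace ℝ (Fin N) → ℝ}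
    (h : u =ᵐ[volume] v) : gagliardoEnergy s p u = gagliardoEnergy s p v := by
  rw [gagliardoEnergy_eq_eLpNorm hp, gagliardoEnergy_eq_eLpNorm hp,
    eLpNorm_congr_ae (gagliardoQuotient_congr_ae h)]

/-- Boundedness of the torsion function for arbitrary `s` and `p`, from the fractional Poincaré
inequality. -/
theorem IsTorsionFunction.exists_ae_le (hN : 1 ≤ N) (hι : IsL1Embedding ι)
    {w : HomogeneousSobolev hs hp Ω} (hw : IsTorsionFunction ι w) :
    ∃ M : ℝ, ∀ᵐ x, zeroExtension ι w x ≤ M := by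
  have hp0 : 0 < p := by linarith
  have hs0 := hs.1
  have hN0 : (0 : ℝ) < N := by exact_mod_cast hN
  obtain ⟨C, hC, hpoin⟩ := exists_lintegral_rpow_le_gagliardoEnergy hN hs hp
  refine ⟨_, hw.ae_le hN hι (Real.rpow_pos_of_pos hC (1 / p)) fun k hk v hv => ?_⟩
  set A := {x | k < zeroExtension ι w x}
  have hA : MeasurableSet A := measurableSet_lt measurable_const (measurable_zeroExtension w)
  have hAfin : volume A ≠ ∞ := ((integrable_zeroExtension (ι := ι) w).measure_gt_lt_top hk).ne
  have hoff : ∀ x ∉ A, max (zeroExtension ι w x - k) 0 = 0 := fun x hx =>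
    max_eq_right (sub_nonpos.2 (not_lt.1 hx))
  have h1 := hpoin (fun x => max (zeroExtension ι w x - k) 0) A
    (by have := measurable_zeroExtension (ι := ι) w; fun_prop) hAfin hoff
  rw [← gagliardoEnergy_congr_ae hp hv, gagliardoEnergy_zeroExtension hι,
    ← ofReal_measureReal hAfin,
    ENNReal.ofReal_rpow_of_nonneg measureReal_nonneg (by positivity),
    ← ENNReal.ofReal_mul hC.le, ← ENNReal.ofReal_mul (by positivity)] at h1
  set m := volume.real A
  have hm0 : 0 ≤ m := measureReal_nonneg
  have h2 : eLpNorm (zeroExtension ι v) (ENNReal.ofReal p) volume ≤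
      ENNReal.ofReal (C ^ (1 / p) * m ^ (s / N) * ‖v‖) := by
    rw [eLpNorm_congr_ae hv, eLpNorm_eq_lintegral_rpow_enorm_toReal (by simpa using hp0)
      ENNReal.ofReal_ne_top, ENNReal.toReal_ofReal hp0.le]
    have h3 : ∀ x, ‖max (zeroExtension ι w x - k) 0‖ₑ ^ p =
        ENNReal.ofReal (|max (zeroExtension ι w x - k) 0| ^ p) := fun x => by
      rw [← ofReal_norm, ENNReal.ofReal_rpow_of_nonneg (norm_nonneg _) hp0.le, Real.norm_eq_abs]
    simp only [h3]
    refine (ENNReal.rpow_le_rpow h1 (by positivity)).trans (le_of_eq ?_)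
    rw [ENNReal.ofReal_rpow_of_nonneg (by positivity) (by positivity),
      Real.mul_rpow (by positivity) (by positivity), Real.mul_rpow (by positivity) (by positivity),
      ← Real.rpow_mul hm0, ← Real.rpow_mul (norm_nonneg v), mul_one_div_cancel hp0.ne',
      Real.rpow_one]
    congr 4
    field_simp
  have h4 := integral_le_eLpNorm_mul_rpow (integrable_zeroExtension v) hA hAfin
    (by filter_upwards [hv] with x hx hxA using hx.trans (hoff x hxA)) hp.le (by positivity) h2
  refine h4.trans (le_of_eq ?_)
  rw [Real.rpow_add_of_nonneg hm0 (sub_nonneg.2 ((div_le_one hp0).2 hp.le)) (by positivity)]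
  ring

/-- The bound on the torsion function with the best Sobolev constant. -/
theorem IsTorsionFunction.ae_le_of_sobolev (hN : 1 ≤ N) (hsp : s * p < N) (hι : IsL1Embedding ι)
    {w : HomogeneousSobolev hs hp Ω} (hw : IsTorsionFunction ι w) :
    ∀ᵐ x, zeroExtension ι w x ≤
      (N + s * p.conjExponent) / (s * p.conjExponent) *
        sobolevConst N s p ^ (-(N / (N * p + s * p - N))) *
        (∫ x, zeroExtension ι w x) ^ (s * p.conjExponent / (N + s * p.conjExponent)) := by
  have hp0 : 0 < p := by linarith
  have hs0 := hs.1
  have hN0 : (0 : ℝ) < N := by exact_mod_cast hN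
  have hNsp : 0 < N - s * p := by linarith
  have hS := sobolevConst_pos hN hs hp hsp
  have h := hw.ae_le hN hι (Real.rpow_pos_of_pos hS (-(1 / p))) fun k hk v hv => by
    have hA : MeasurableSet {x | k < zeroExtension ι w x} :=
      measurableSet_lt measurable_const (measurable_zeroExtension w)
    have hexp : 1 - 1 / (N * p / (N - s * p)) = 1 - 1 / p + s / N := by
      field_simp
      ring
    have hP : 1 ≤ N * p / (N - s * p) := by
      rw [le_div_iff₀ hNsp]
      nlinarith [mul_pos hs0 hp0, mul_pos hN0 (sub_pos.2 hp)]
    rw [← hexp]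
    refine integral_le_eLpNorm_mul_rpow (integrable_zeroExtension v) hA
      ((integrable_zeroExtension (ι := ι) w).measure_gt_lt_top hk).ne ?_ hP (by positivity)
      (eLpNorm_zeroExtension_le hN hsp hι v)
    filter_upwards [hv] with x hx hxA
    exact hx.trans (max_eq_right (by linarith [not_lt.1 hxA]))
  have he : (sobolevConst N s p ^ (-(1 / p))) ^ (1 / (1 - 1 / p + s / N)) =
      sobolevConst N s p ^ (-(N / (N * p + s * p - N))) := by
    rw [← Real.rpow_mul hS.le]
    congr 1
    have h1 : 1 - 1 / p + s / N = (N * p + s * p - N) / (p * N) := by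
      field_simp
      ring
    rw [h1, one_div_div]
    have h2 : N * p + s * p - N ≠ 0 := by
      nlinarith [mul_pos hs0 hp0, mul_pos hN0 (sub_pos.2 hp)]
    field_simp
  rwa [he] at h

end Boundedness

/-! ### The torsion function -/

theorem proposition3p2 {N : ℕ} (hN : 1 ≤ N) {s p : ℝ} (hs : s ∈ Ioo (0 : ℝ) 1) (hp : 1 < p)
    (Ω : Opens (EuclideanSpace ℝ (Fin N)))
    (ι : HomogeneousSobolev hs hp Ω →L[ℝ]
      Lp ℝ 1 (volume.restrict (Ω : Set (EuclideanSpace ℝ (Fin N)))))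
    (hι : IsL1Embedding ι) (hcompact : IsCompactOperator ι) :
    (∃! w : HomogeneousSobolev hs hp Ω, IsTorsionFunction ι w) ∧
    ∀ w : HomogeneousSobolev hs hp Ω, IsTorsionFunction ι w →
      MemLp (ι w) ∞ (volume.restrict (Ω : Set (EuclideanSpace ℝ (Fin N)))) ∧
      (s * p < N →
        (eLpNorm (ι w) ∞ (volume.restrict (Ω : Set (EuclideanSpace ℝ (Fin N))))).toReal ≤
          (N + s * p.conjExponent) / (s * p.conjExponent) *
            sobolevConst N s p ^ (-(N / (N * p + s * p - N))) *
            (∫ x in (Ω : Set (EuclideanSpace ℝ (Fin N))), ι w x) ^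
              (s * p.conjExponent / (N + s * p.conjExponent))) := by
  refine ⟨existsUnique_isTorsionFunction hι, fun w hw => ?_⟩
  have hnonneg := hw.zeroExtension_nonneg hι
  have hrestrict : ∀ M : ℝ, (∀ᵐ x, zeroExtension ι w x ≤ M) →
      ∀ᵐ x ∂volume.restrict (Ω : Set (EuclideanSpace ℝ (Fin N))), ‖ι w x‖ ≤ M := by
    intro M hM
    refine (ae_restrict_iff' Ω.isOpen.measurableSet).2 ?_
    filter_upwards [hnonneg, hM] with x h1 h2 hx
    rw [zeroExtension, indicator_of_mem hx] at h1 h2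
    rwa [Real.norm_of_nonneg h1]
  constructor
  · obtain ⟨M, hM⟩ := hw.exists_ae_le hN hι
    exact memLp_top_of_bound (Lp.aestronglyMeasurable _) M (hrestrict M hM)
  · intro hsp
    have hM := hw.ae_le_of_sobolev hN hsp hι
    rw [integral_zeroExtension] at hM
    refine ENNReal.toReal_le_of_le_ofReal ?_ ?_
    · have h1 : 0 ≤ ∫ x in (Ω : Set (EuclideanSpace ℝ (Fin N))), ι w x := by
        rw [← integral_zeroExtension]
        exact integral_nonneg_of_ae hnonneg
      have h2 := (sobolevConst_pos hN hs hp hsp).le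
      have h3 : 0 < p.conjExponent := (Real.HolderConjugate.conjExponent hp).symm.pos
      have h4 := hs.1
      positivity
    · rw [eLpNorm_exponent_top]
      exact eLpNormEssSup_le_of_ae_bound (hrestrict _ hM)
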